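/- Let $U\subseteq\mathbb R^2$ be an open set containing the origin and let $p,q$ be real-analytic functions on $U$ whose Maclaurin series contain only terms of degree at least $2$. Let $\Phi(x)=x/|x|^2$ be the geometric inversion. Consider the system $$\dot u=-v+(v^2-u^2)\tilde p-2uv\,\tilde q,\qquad \dot v=u+(u^2-v^2)\tilde q-2uv\,\tilde p, \tag{S}$$ on $\{w=(u,v)\ne 0:\Phi(w)\in U\}$, where $\tilde p=p\left(\frac u{u^2+v^2},\frac v{u^2+v^2}\right)$ and $\tilde q=q\left(\frac u{u^2+v^2},\frac v{u^2+v^2}\right)$; it is obtained from $\dot x=-y+p(x,y)$, $\dot y=x+q(x,y)$ by the change of variables $(u,v)=\Phi(x,y)$. The Lyapunov coefficients $V_j$ of (S) at infinity are, by definition, those at the origin of the system obtained from (S) by geometric inversion, that is, $V_j$ is the coefficient of $r^j$ in the Taylor expansion at $r=0$ of the displacement function $P(r)-r$, where $P$ is the first return (Poincaré) map of that system on the positive $x$-axis, with $P(0)=0$. Suppose that $V_{2k+1}$ is the first nonzero one, that is, $V_{2k+1}\neq0$ and $V_j=0$ for all $j<2k+1$. Let $\Gamma$ be an unbounded (spiral)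 trajectory of (S), away from the origin, i.e. $\inf_{w\in\Gamma}|w|>0$; here a trajectory starts from an initial point and is followed for all later times or for all earlier times. Then $$\dim_B\Gamma=2\left(1-\frac1{2k+1}\right),$$ and $\Gamma$ is Minkowski nondegenerate. Here, for an unbounded set $A\subset\mathbb R^n$ away from the origin, the upper and lower box dimensions of $A$ are those of the bounded set $\Phi(A)$, and $A$ is called Minkowski nondegenerate if $\Phi(A)$ is. For a bounded set $B\subset\mathbb R^n$ with open $\varepsilon$-neighbourhood $B_\varepsilon$, the upper and lower $s$-dimensional Minkowski contents $\mathcal M^{*s}(B)$ and $\mathcal M_*^s(B)$ are the $\limsup$ and the $\liminf$ of $|B_\varepsilon|/\varepsilon^{n-s}$ as $\varepsilon\to0^+$. The upper box dimension is $\inf\{s>0:\mathcal M^{*s}(B)=0\}$ and the lower one is $\inf\{s>0:\mathcal M_*^{s}(B)=0\}$; $\dim_B$ denotes their common value when they are equal (which is part of the claim). $B$ is Minkowski nondegenerate if $0<\mathcal M_*^d(B)\le\mathcal M^{*d}(B)<\infty$ for some $d\ge0$. -/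

import Mathlib

open Set Filter Topology MeasureTheory
open scoped ENNReal

/-- The Euclidean plane. -/
abbrev Plane : Type := EuclideanSpace ℝ (Fin 2)

/-! ### Minkowski contents and box dimensions of bounded sets in `ℝⁿ` -/

noncomputable section

/-- The quotient `|A_ε| / ε^(n-s)`, where `A_ε` is the open Euclidean `ε`-neighbourhood of `A`. -/
def minkowskiQuotient {n : ℕ} (s : ℝ) (A : Set (EuclideanSpace ℝ (Fin n))) (ε : ℝ) : ℝ≥0∞ :=
  volume (Metric.thickening ε A) / ENNReal.ofReal (ε ^ ((n : ℝ) - s))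

/-- Upper `s`-dimensional Minkowski content. -/
def upperMinkowskiContent {n : ℕ} (s : ℝ) (A : Set (EuclideanSpace ℝ (Fin n))) : ℝ≥0∞ :=
  limsup (minkowskiQuotient s A) (𝓝[>] (0 : ℝ))

/-- Lower `s`-dimensional Minkowski content. -/
def lowerMinkowskiContent {n : ℕ} (s : ℝ) (A : Set (EuclideanSpace ℝ (Fin n))) : ℝ≥0∞ :=
  liminf (minkowskiQuotient s A) (𝓝[>] (0 : ℝ))

/-- Upper box dimension of a bounded set. -/
def upperBoxDim {n : ℕ} (A : Set (EuclideanSpace ℝ (Fin n))) : ℝ :=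
  sInf {s : ℝ | 0 < s ∧ upperMinkowskiContent s A = 0}

/-- Lower box dimension of a bounded set. -/
def lowerBoxDim {n : ℕ} (A : Set (EuclideanSpace ℝ (Fin n))) : ℝ :=
  sInf {s : ℝ | 0 < s ∧ lowerMinkowskiContent s A = 0}

/-- Minkowski nondegeneracy of a bounded set. -/
def MinkowskiNondegenerate {n : ℕ} (A : Set (EuclideanSpace ℝ (Fin n))) : Prop :=
  ∃ d : ℝ, 0 ≤ d ∧ 0 < lowerMinkowskiContent d A ∧
    lowerMinkowskiContent d A ≤ upperMinkowskiContent d A ∧ upperMinkowskiContent d A < ∞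

/-! ### Geometric inversion and unbounded sets away from the origin -/

/-- The geometric inversion `Φ(x) = x / |x|²`. -/
def geomInversion {n : ℕ} : EuclideanSpace ℝ (Fin n) → EuclideanSpace ℝ (Fin n) :=
  EuclideanGeometry.inversion 0 1

theorem geomInversion_apply {n : ℕ} (x : EuclideanSpace ℝ (Fin n)) :
    geomInversion x = (‖x‖ ^ 2)⁻¹ • x := by
  simp [geomInversion, EuclideanGeometry.inversion]

/-- `A` has a positive distance from the origin. -/
def AwayFromOrigin {n : ℕ} (A : Set (EuclideanSpace ℝ (Fin n))) : Prop :=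
  ∃ δ : ℝ, 0 < δ ∧ ∀ a ∈ A, δ ≤ ‖a‖

/-- The unbounded set `A`, away from the origin, has box dimension `d`: the upper and the lower
box dimension of its geometric inverse are both equal to `d`. -/
def HasUnboundedBoxDim {n : ℕ} (A : Set (EuclideanSpace ℝ (Fin n))) (d : ℝ) : Prop :=
  upperBoxDim (geomInversion '' A) = d ∧ lowerBoxDim (geomInversion '' A) = d

/-- The unbounded set `A`, away from the origin, is Minkowski nondegenerate: its geometric
inverse is. -/
def UnboundedMinkowskiNondegenerate {n : ℕ} (A : Set (EuclideanSpace ℝ (Fin n))) : Prop :=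
  MinkowskiNondegenerate (geomInversion '' A)

/-- The vector field of the system obtained from `ẋ = X(x)` by the change of variables
`u = x / |x|²`, namely `u̇ = |u|² X(u/|u|²) - 2 (u · X(u/|u|²)) u`. -/
def invertField {n : ℕ} (X : EuclideanSpace ℝ (Fin n) → EuclideanSpace ℝ (Fin n))
    (u : EuclideanSpace ℝ (Fin n)) : EuclideanSpace ℝ (Fin n) :=
  ‖u‖ ^ 2 • X (geomInversion u) - (2 * inner ℝ u (X (geomInversion u))) • u

/-- The domain, in `ℝⁿ ∖ {0}`, of the inverted system of a system with domain `D`. -/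
def invertDomain {n : ℕ} (D : Set (EuclideanSpace ℝ (Fin n))) :
    Set (EuclideanSpace ℝ (Fin n)) :=
  {u | u ≠ 0 ∧ geomInversion u ∈ D}

/-! ### Solutions, semitrajectories, return map, Lyapunov coefficients -/

/-- `γ` is a solution, on the time interval `I`, of the autonomous system `ẋ = X(x)`, `x ∈ D`. -/
def IsSolutionOn (X : Plane → Plane) (D : Set Plane) (γ : ℝ → Plane) (I : Set ℝ) : Prop :=
  MapsTo γ I D ∧ IsIntegralCurveOn γ (fun _ => X) I

/-- `Γ` is a trajectory of `ẋ = X(x)`, `x ∈ D`, starting from an initial point and followed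
for all later times or for all earlier times. -/
def IsSemitrajectory (X : Plane → Plane) (D : Set Plane) (Γ : Set Plane) : Prop :=
  ∃ (γ : ℝ → Plane) (t₀ : ℝ) (I : Set ℝ), (I = Ici t₀ ∨ I = Iic t₀) ∧
    IsSolutionOn X D γ I ∧ Γ = γ '' I

/-- `(s, 0)`, `s > 0`, is the first point in which the solution starting at `(r, 0)` returns to
the positive half of the horizontal axis. -/
def IsFirstReturn (X : Plane → Plane) (D : Set Plane) (r s : ℝ) : Prop :=
  ∃ (γ : ℝ → Plane) (T : ℝ), 0 < T ∧ IsSolutionOn X D γ (Icc 0 T) ∧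
    γ 0 = !₂[r, 0] ∧ γ T = !₂[s, 0] ∧ 0 < s ∧
    ∀ t ∈ Ioo 0 T, ¬ (0 < γ t 0 ∧ γ t 1 = 0)

open Classical in
/-- The Poincaré (first return) map on the positive half of the horizontal axis. Where there is
no return it has the value `0`; in particular it maps `0` to `0` when the origin is an
equilibrium. -/
def poincareMap (X : Plane → Plane) (D : Set Plane) (r : ℝ) : ℝ :=
  if h : ∃ s, IsFirstReturn X D r s then h.choose else 0

/-- The displacement function `P(r) - r`. -/
def displacement (X : Plane → Plane) (D : Set Plane) (r : ℝ) : ℝ :=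
  poincareMap X D r - r

/-- The `j`-th Lyapunov coefficient at the origin: the coefficient of `r^j` in the Taylor
expansion of the displacement function at `0` on the half-axis `r ≥ 0`. -/
def lyapunovCoeff (X : Plane → Plane) (D : Set Plane) (j : ℕ) : ℝ :=
  iteratedDerivWithin j (displacement X D) (Ici 0) 0 / (j.factorial : ℝ)

/-- The `j`-th Lyapunov coefficient at infinity: the one at the origin of the inverted system. -/
def lyapunovCoeffAtInfinity (X : Plane → Plane) (D : Set Plane) (j : ℕ) : ℝ :=
  lyapunovCoeff (invertField X) (invertDomain D) j

/-! ### Systems of weak focus type -/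

/-- The field `(-y + p(x,y), x + q(x,y))`. -/
def weakFocusField (p q : Plane → ℝ) (z : Plane) : Plane :=
  !₂[-(z 1) + p z, z 0 + q z]

/-- With `w = (u, v)`, `p̃ = p(w/|w|²)` and `q̃ = q(w/|w|²)`, the field
`(-v + (v² - u²) p̃ - 2uv q̃, u + (u² - v²) q̃ - 2uv p̃)`. -/
def invertedWeakFocusField (p q : Plane → ℝ) (w : Plane) : Plane :=
  !₂[-(w 1) + (w 1 ^ 2 - w 0 ^ 2) * p (geomInversion w)
        - 2 * w 0 * w 1 * q (geomInversion w),
     w 0 + (w 0 ^ 2 - w 1 ^ 2) * q (geomInversion w)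
        - 2 * w 0 * w 1 * p (geomInversion w)]

/-- The explicit field above is the one obtained by inversion from the weak focus field. -/
theorem invertField_weakFocusField (p q : Plane → ℝ) {w : Plane} (hw : w ≠ 0) :
    invertField (weakFocusField p q) w = invertedWeakFocusField p q w := by
  have hn : ‖w‖ ^ 2 = w 0 ^ 2 + w 1 ^ 2 := by
    rw [EuclideanSpace.norm_sq_eq]; simp [Fin.sum_univ_two]
  have hne : w 0 ^ 2 + w 1 ^ 2 ≠ 0 := by
    rw [← hn]; exact pow_ne_zero 2 (norm_ne_zero_iff.mpr hw)
  have h0 : geomInversion w 0 = (w 0 ^ 2 + w 1 ^ 2)⁻¹ * w 0 := by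
    rw [geomInversion_apply, hn]; simp
  have h1 : geomInversion w 1 = (w 0 ^ 2 + w 1 ^ 2)⁻¹ * w 1 := by
    rw [geomInversion_apply, hn]; simp
  ext i
  fin_cases i <;>
    simp [invertField, weakFocusField, invertedWeakFocusField, hn, h0, h1, PiLp.inner_apply,
      Fin.sum_univ_two] <;> field_simp <;> ring

/-- A real function on the open set `U` containing the origin, analytic on `U`, whose Maclaurin
series contains only terms of degree at least two. -/
def IsAnalyticOrderTwo (p : Plane → ℝ) (U : Set Plane) : Prop :=
  AnalyticOnNhd ℝ p U ∧ p 0 = 0 ∧ fderiv ℝ p 0 = 0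

end

/-! Inversion turns `Γ` into an orbit of the weak focus system, followed in one time direction `σ =
±1`; unboundedness of `Γ` says that this orbit comes arbitrarily close to the origin. In complex
notation the system is `ζ' = σ ζ (i + G(ζ))`, where `G = (p + iq)/z` is `O(|z|)` and Lipschitz near
`0` (`exists_isSmallPerturbation`). The angle can therefore serve as time, and the radius solves
`dρ/dθ = F(θ, ρ)` with `|F| ≤ 2Cρ²` and `F` Lipschitz in `ρ` (`exists_polarOrbit`,
`IsComplexOrbit.exists_polar`).

Put `m = 2k+1`. Consecutive radii on the positive axis differ by the displacement `f`, and `f(r) ~ V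
r^m`, so the gaps there are comparable to `ρ^m`. Grönwall carries the upper gap bound to all angles
(`IsPolarOrbit.isPowerSpiral`). At scale `ε`, turns with radius below a multiple of `ε^(1/m)` have
gaps below `ε`, and their neighbourhoods fill a disc of area of order `ε^(2/m)`. The outer turns
contribute at most a multiple of `ε ∑ ρ_n`, and a telescoping estimate (`IsPowerSpiral.sum_le`)
bounds this by the same order. Thus `|A_ε|` is of order `ε^(2/m)`, which gives the dimension `2 -
2/m` and both content bounds at once (`boxDim_of_volume_thickening_bounds`).

Smoothness of the return map is never established from the differential equation. The leading term
of `f` is extracted from the values of the iterated derivatives at `0` alone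
(`tendsto_div_pow_of_iteratedDerivWithin`): a nonzero derivative forces genuine differentiability,
and this propagates down through the orders. The only extra input is that `f` is quadratically small
at arbitrarily small radii, and the orbit itself supplies such radii (`frequently_displacement_le`).
The same input excludes `k = 0`. The sign of `V` then has to agree with the time direction, since
otherwise stability in reversed time would keep the orbit away from the origin
(`IsComplexOrbit.not_outward`). -/

/-! ### Taylor coefficients on a half-line -/

/-- A strictly increasing function that is nonpositive at one point is negative to the left of it,
so only one sign survives near `0`. No limit at `0` is needed. -/
theorem eventually_sign_of_hasDerivAt_pos {u u' : ℝ → ℝ}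
    (hu : ∀ᶠ x in 𝓝[>] (0 : ℝ), HasDerivAt u (u' x) x) (hpos : ∀ᶠ x in 𝓝[>] (0 : ℝ), 0 < u' x) :
    (∀ᶠ x in 𝓝[>] (0 : ℝ), 0 < u x) ∨ ∀ᶠ x in 𝓝[>] (0 : ℝ), u x < 0 := by
  obtain ⟨δ, hδ, h⟩ := mem_nhdsGT_iff_exists_Ioo_subset.1 (hu.and hpos)
  have hδ : (0 : ℝ) < δ := hδ
  have hmono : StrictMonoOn u (Ioo 0 δ) := by
    refine strictMonoOn_of_deriv_pos (convex_Ioo 0 δ)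
      (fun x hx => (h hx).1.continuousAt.continuousWithinAt) fun x hx => ?_
    rw [interior_Ioo] at hx
    rw [(h hx).1.deriv]
    exact (h hx).2
  by_cases hx : ∃ x₀ ∈ Ioo 0 δ, u x₀ ≤ 0
  · obtain ⟨x₀, hx₀, hle⟩ := hx
    right
    filter_upwards [Ioo_mem_nhdsGT hx₀.1] with x hx
    exact (hmono ⟨hx.1, hx.2.trans hx₀.2⟩ hx₀ hx.2).trans_le hle
  · left
    push Not at hx
    filter_upwards [Ioo_mem_nhdsGT hδ] with x hx' using hx x hx'

theorem eventually_sign_of_hasDerivAt {u u' : ℝ → ℝ}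
    (hu : ∀ᶠ x in 𝓝[>] (0 : ℝ), HasDerivAt u (u' x) x)
    (hs : (∀ᶠ x in 𝓝[>] (0 : ℝ), 0 < u' x) ∨ ∀ᶠ x in 𝓝[>] (0 : ℝ), u' x < 0) :
    (∀ᶠ x in 𝓝[>] (0 : ℝ), 0 < u x) ∨ ∀ᶠ x in 𝓝[>] (0 : ℝ), u x < 0 := by
  rcases hs with hs | hs
  · exact eventually_sign_of_hasDerivAt_pos hu hs
  · have := eventually_sign_of_hasDerivAt_pos (u := fun x => -u x) (u' := fun x => -u' x)
      (hu.mono fun x hx => hx.neg) (hs.mono fun x hx => neg_pos.2 hx)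
    rcases this with h | h
    · exact Or.inr (h.mono fun x hx => neg_pos.1 hx)
    · exact Or.inl (h.mono fun x hx => neg_lt_zero.1 hx)

/-- A bounded derivative makes `u` Lipschitz on some `(0, δ)`; the value at `0` of a Lipschitz
extension is the limit. -/
theorem exists_tendsto_of_hasDerivAt_of_tendsto {u u' : ℝ → ℝ} {l : ℝ}
    (hu : ∀ᶠ x in 𝓝[>] (0 : ℝ), HasDerivAt u (u' x) x) (hl : Tendsto u' (𝓝[>] 0) (𝓝 l)) :
    ∃ l', Tendsto u (𝓝[>] 0) (𝓝 l') := by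
  have hb : ∀ᶠ x in 𝓝[>] (0 : ℝ), |u' x| < |l| + 1 :=
    hl.abs.eventually_lt_const (lt_add_one _)
  obtain ⟨δ, hδ, h⟩ := mem_nhdsGT_iff_exists_Ioo_subset.1 (hu.and hb)
  have hδ : (0 : ℝ) < δ := hδ
  have hlip : LipschitzOnWith (Real.toNNReal (|l| + 1)) u (Ioo 0 δ) := by
    refine (convex_Ioo 0 δ).lipschitzOnWith_of_nnnorm_hasDerivWithin_le
      (fun x hx => (h hx).1.hasDerivWithinAt) fun x hx => ?_
    rw [← NNReal.coe_le_coe, coe_nnnorm, Real.norm_eq_abs, Real.coe_toNNReal _ (by positivity)]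
    exact (h hx).2.le
  obtain ⟨w, hw, heq⟩ := hlip.extend_real
  refine ⟨w 0, (hw.continuous.continuousAt.mono_left nhdsWithin_le_nhds).congr' ?_⟩
  filter_upwards [Ioo_mem_nhdsGT hδ] with x hx using (heq hx).symm

theorem iteratedDerivWithin_Ici_succ_eq_deriv (f : ℝ → ℝ) (j : ℕ) {x : ℝ} (hx : 0 < x) :
    iteratedDerivWithin (j + 1) f (Ici 0) x = deriv (iteratedDerivWithin j f (Ici 0)) x := by
  rw [iteratedDerivWithin_succ, derivWithin_of_mem_nhds (Ici_mem_nhds hx)]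

theorem tendsto_div_of_hasDerivWithinAt_Ici {g : ℝ → ℝ} {a : ℝ}
    (h : HasDerivWithinAt g a (Ici 0) 0) (h0 : g 0 = 0) :
    Tendsto (fun x => g x / x) (𝓝[>] 0) (𝓝 a) := by
  have := (hasDerivWithinAt_iff_tendsto_slope.1 h)
  rw [Ici_sdiff_left] at this
  refine this.congr fun x => ?_
  simp [slope_def_field, h0]

/-- If the first `n` derivatives of `f` at `0` on the half-line `[0, ∞)` vanish and the next one
does not, and `f` is quadratically small at arbitrarily small points, then `f` has the expected
leading term. No differentiability needs to be assumed: it follows from a derivative not being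
zero. -/
theorem tendsto_div_pow_of_iteratedDerivWithin {f : ℝ → ℝ} {n : ℕ} {C : ℝ}
    (h0 : ∀ j ≤ n, iteratedDerivWithin j f (Ici 0) 0 = 0)
    (hn : iteratedDerivWithin (n + 1) f (Ici 0) 0 ≠ 0)
    (hfreq : ∃ᶠ r in 𝓝[>] (0 : ℝ), |f r| ≤ C * r ^ 2) :
    Tendsto (fun r => f r / r ^ (n + 1)) (𝓝[>] 0)
      (𝓝 (iteratedDerivWithin (n + 1) f (Ici 0) 0 / (n + 1).factorial)) := by
  set g : ℕ → ℝ → ℝ := fun j => iteratedDerivWithin j f (Ici 0) with hg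
  set a := iteratedDerivWithin (n + 1) f (Ici 0) 0 with ha
  -- `derivWithin` is `0` where the function is not differentiable, so a nonzero value certifies a
  -- derivative.
  have hgn : HasDerivWithinAt (g n) a (Ici 0) 0 := by
    have hd : a = derivWithin (g n) (Ici 0) 0 := by rw [ha, iteratedDerivWithin_succ]
    rw [hd]
    refine DifferentiableWithinAt.hasDerivWithinAt ?_
    by_contra hnd
    exact hn (hd.trans (derivWithin_zero_of_not_differentiableWithinAt hnd))
  have hgn1 : Tendsto (fun x => g n x / x) (𝓝[>] 0) (𝓝 a) :=
    tendsto_div_of_hasDerivWithinAt_Ici hgn (h0 n le_rfl)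
  have hpos : ∀ᶠ x in 𝓝[>] (0 : ℝ), 0 < x := self_mem_nhdsWithin
  -- Descending induction on the order: if `g (j+1)` has a strict sign near `0`, it is a nonzero
  -- value of `deriv (g j)`, so `g j` is differentiable there with derivative `g (j+1)` and inherits
  -- a strict sign and a limit.
  have hA : ∀ i ≤ n, ((∀ᶠ x in 𝓝[>] (0 : ℝ), 0 < g (n - i) x) ∨
      ∀ᶠ x in 𝓝[>] (0 : ℝ), g (n - i) x < 0) ∧ ∃ l, Tendsto (g (n - i)) (𝓝[>] 0) (𝓝 l) := by
    intro i
    induction i with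
    | zero =>
      intro _
      refine ⟨?_, g n 0, hgn.continuousWithinAt.mono_left (nhdsWithin_mono _ Ioi_subset_Ici_self)⟩
      rcases lt_or_gt_of_ne hn with hlt | hgt
      · right
        filter_upwards [hgn1.eventually_lt_const hlt, hpos] with x hx hx0
        simpa using (div_neg_iff.1 hx).resolve_left (fun h => (h.2.trans hx0).false) |>.1
      · left
        filter_upwards [hgn1.eventually_const_lt hgt, hpos] with x hx hx0
        simpa using (div_pos_iff.1 hx).resolve_right (fun h => (h.2.trans hx0).false) |>.1
    | succ i ih =>
      intro hi
      obtain ⟨hs, l, hl⟩ := ih (by omega)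
      have hidx : n - i = n - (i + 1) + 1 := by omega
      rw [hidx] at hs hl
      have hd : ∀ᶠ x in 𝓝[>] (0 : ℝ),
          HasDerivAt (g (n - (i + 1))) (g (n - (i + 1) + 1) x) x := by
        have hne : ∀ᶠ x in 𝓝[>] (0 : ℝ), g (n - (i + 1) + 1) x ≠ 0 := by
          rcases hs with hs | hs
          · exact hs.mono fun x hx => hx.ne'
          · exact hs.mono fun x hx => hx.ne
        filter_upwards [hne, hpos] with x hx hx0
        have he := iteratedDerivWithin_Ici_succ_eq_deriv f (n - (i + 1)) hx0
        simp only [hg] at hx ⊢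
        rw [he] at hx ⊢
        exact (differentiableAt_of_deriv_ne_zero hx).hasDerivAt
      exact ⟨eventually_sign_of_hasDerivAt hd hs, exists_tendsto_of_hasDerivAt_of_tendsto hd hl⟩
  have hA' : ∀ j ≤ n, ((∀ᶠ x in 𝓝[>] (0 : ℝ), 0 < g j x) ∨
      ∀ᶠ x in 𝓝[>] (0 : ℝ), g j x < 0) ∧ ∃ l, Tendsto (g j) (𝓝[>] 0) (𝓝 l) := by
    intro j hj
    have := hA (n - j) (by omega)
    rwa [show n - (n - j) = j by omega] at this
  have hD : ∀ j < n, ∀ᶠ x in 𝓝[>] (0 : ℝ), HasDerivAt (g j) (g (j + 1) x) x := by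
    intro j hj
    have hne : ∀ᶠ x in 𝓝[>] (0 : ℝ), g (j + 1) x ≠ 0 := by
      rcases (hA' (j + 1) hj).1 with hs | hs
      · exact hs.mono fun x hx => hx.ne'
      · exact hs.mono fun x hx => hx.ne
    filter_upwards [hne, hpos] with x hx hx0
    have he := iteratedDerivWithin_Ici_succ_eq_deriv f j hx0
    simp only [hg] at hx ⊢
    rw [he] at hx ⊢
    exact (differentiableAt_of_deriv_ne_zero hx).hasDerivAt
  -- Ascending induction. For `j = 0` the limit vanishes because of `hfreq`. Afterwards the limit of
  -- `g (j+1)` is the one-sided derivative of `g j` at `0`, which is zero by `h0`.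
  have hT : ∀ j ≤ n, Tendsto (g j) (𝓝[>] 0) (𝓝 0) := by
    intro j
    induction j with
    | zero =>
      intro _
      obtain ⟨l, hl⟩ := (hA' 0 (Nat.zero_le _)).2
      have hl' : Tendsto (fun r => |g 0 r| - C * r ^ 2) (𝓝[>] 0) (𝓝 (|l| - C * 0 ^ 2)) :=
        hl.abs.sub (((continuous_const.mul (continuous_pow 2)).tendsto 0).mono_left
          nhdsWithin_le_nhds)
      have : |l| - C * 0 ^ 2 ≤ 0 := by
        by_contra hcon
        push Not at hcon
        refine hfreq ?_
        filter_upwards [hl'.eventually_const_lt hcon] with r hr hle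
        simp only [hg, iteratedDerivWithin_zero] at hr
        linarith
      have hl0 : l = 0 := by
        rw [← abs_nonpos_iff]
        simpa using this
      rwa [hl0] at hl
    | succ j ih =>
      intro hj
      obtain ⟨l, hl⟩ := (hA' (j + 1) hj).2
      have hj0 : g j 0 = 0 := h0 j (by omega)
      obtain ⟨δ, hδ, hsub⟩ := mem_nhdsGT_iff_exists_Ioo_subset.1 (hD j (by omega))
      have hδ : (0 : ℝ) < δ := hδ
      have hder : HasDerivWithinAt (g j) l (Ici 0) 0 := by
        refine hasDerivWithinAt_Ici_of_tendsto_deriv (s := Ioo 0 δ)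
          (fun x hx => (hsub hx).differentiableAt.differentiableWithinAt) ?_
          (Ioo_mem_nhdsGT hδ) (hl.congr' ?_)
        · have : Tendsto (g j) (𝓝[>] 0) (𝓝 (g j 0)) := by
            rw [hj0]
            exact ih (by omega)
          exact this.mono_left (nhdsWithin_mono _ fun x hx => hx.1)
        · filter_upwards [Ioo_mem_nhdsGT hδ] with x hx using ((hsub hx).deriv).symm
      have : g (j + 1) 0 = l := by
        simp only [hg]
        rw [iteratedDerivWithin_succ]
        exact hder.derivWithin (uniqueDiffOn_Ici 0 0 self_mem_Ici)
      rw [show l = 0 from this.symm.trans (h0 (j + 1) hj)] at hl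
      exact hl
  -- Descending again, by l'Hôpital's rule.
  have hfin : ∀ i ≤ n, Tendsto (fun r => g (n - i) r / r ^ (i + 1)) (𝓝[>] 0)
      (𝓝 (a / (i + 1).factorial)) := by
    intro i
    induction i with
    | zero => intro _; simpa using hgn1
    | succ i ih =>
      intro hi
      have hidx : n - i = n - (i + 1) + 1 := by omega
      have ih' := ih (by omega)
      rw [hidx] at ih'
      refine HasDerivAt.lhopital_zero_nhdsGT (f' := g (n - (i + 1) + 1))
        (g' := fun r => ((i + 1 + 1 : ℕ) : ℝ) * r ^ (i + 1))
        (hD _ (by omega)) (Eventually.of_forall fun x => hasDerivAt_pow _ x) ?_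
        (hT _ (by omega)) ?_ ?_
      · filter_upwards [hpos] with x hx
        positivity
      · exact (Continuous.tendsto' (by fun_prop) 0 0 (by simp)).mono_left nhdsWithin_le_nhds
      · have := ih'.div_const ((i + 1 + 1 : ℕ) : ℝ)
        rw [Nat.factorial_succ (i + 1)]
        convert this using 2
        · rw [div_div, mul_comm]
        · push_cast
          rw [div_div, mul_comm]
  have := hfin n le_rfl
  simpa [hg] using this

/-! ### Box dimension from the volume of neighbourhoods -/

theorem ofReal_mul_rpow_div_ofReal_rpow {c d s ε : ℝ} (hε : 0 < ε) :
    ENNReal.ofReal (c * ε ^ (2 - d)) / ENNReal.ofReal (ε ^ (((2 : ℕ) : ℝ) - s)) =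
      ENNReal.ofReal (c * ε ^ (s - d)) := by
  rw [← ENNReal.ofReal_div_of_pos (Real.rpow_pos_of_pos hε _), mul_div_assoc, ← Real.rpow_sub hε]
  congr 3
  push_cast
  ring

/-- The Minkowski quotient lies between `c ε^(s-d)` and `C ε^(s-d)`: it tends to `0` for `s > d` and
stays above `c` for `s ≤ d`. Both sets of exponents in the definitions of the box dimensions are
then exactly `(d, ∞)`. -/
theorem boxDim_of_volume_thickening_bounds {A : Set Plane} {d c C : ℝ} (hd : 0 < d) (hc : 0 < c)
    (hl : ∀ᶠ ε in 𝓝[>] (0 : ℝ),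
      ENNReal.ofReal (c * ε ^ (2 - d)) ≤ volume (Metric.thickening ε A))
    (hu : ∀ᶠ ε in 𝓝[>] (0 : ℝ),
      volume (Metric.thickening ε A) ≤ ENNReal.ofReal (C * ε ^ (2 - d))) :
    upperBoxDim A = d ∧ lowerBoxDim A = d ∧ MinkowskiNondegenerate A := by
  have hpos : ∀ᶠ ε in 𝓝[>] (0 : ℝ), 0 < ε := self_mem_nhdsWithin
  have hQl : ∀ s, ∀ᶠ ε in 𝓝[>] (0 : ℝ),
      ENNReal.ofReal (c * ε ^ (s - d)) ≤ minkowskiQuotient s A ε := by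
    intro s
    filter_upwards [hl, hpos] with ε h hε
    rw [minkowskiQuotient, ← ofReal_mul_rpow_div_ofReal_rpow hε]
    exact ENNReal.div_le_div_right h _
  have hQu : ∀ s, ∀ᶠ ε in 𝓝[>] (0 : ℝ),
      minkowskiQuotient s A ε ≤ ENNReal.ofReal (C * ε ^ (s - d)) := by
    intro s
    filter_upwards [hu, hpos] with ε h hε
    rw [minkowskiQuotient, ← ofReal_mul_rpow_div_ofReal_rpow hε]
    exact ENNReal.div_le_div_right h _
  have hle : ∀ s, lowerMinkowskiContent s A ≤ upperMinkowskiContent s A := fun s =>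
    liminf_le_limsup
  have hbig : ∀ s, d < s → upperMinkowskiContent s A = 0 := by
    intro s hs
    have ht : Tendsto (fun ε : ℝ => ENNReal.ofReal (C * ε ^ (s - d))) (𝓝[>] 0) (𝓝 0) := by
      rw [← ENNReal.ofReal_zero]
      refine ENNReal.tendsto_ofReal ?_
      have : Tendsto (fun ε : ℝ => C * ε ^ (s - d)) (𝓝 0) (𝓝 0) := by
        have h1 := (Real.continuousAt_rpow_const 0 (s - d) (Or.inr (by linarith))).tendsto
        rw [Real.zero_rpow (by linarith)] at h1
        simpa using h1.const_mul C
      exact this.mono_left nhdsWithin_le_nhds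
    exact (tendsto_of_tendsto_of_tendsto_of_le_of_le' tendsto_const_nhds ht
      (Eventually.of_forall fun _ => zero_le) (hQu s)).limsup_eq
  have hsmall : ∀ s, s ≤ d → ENNReal.ofReal c ≤ lowerMinkowskiContent s A := by
    intro s hs
    refine le_liminf_of_le (by isBoundedDefault) ?_
    filter_upwards [hQl s, Ioo_mem_nhdsGT (zero_lt_one' ℝ)] with ε h hε
    refine le_trans (ENNReal.ofReal_le_ofReal ?_) h
    exact le_mul_of_one_le_right hc.le
      (Real.one_le_rpow_of_pos_of_le_one_of_nonpos hε.1 hε.2.le (by linarith))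
  have hcpos : 0 < ENNReal.ofReal c := ENNReal.ofReal_pos.2 hc
  refine ⟨?_, ?_, d, hd.le, hcpos.trans_le (hsmall d le_rfl), hle d, ?_⟩
  · have : {s : ℝ | 0 < s ∧ upperMinkowskiContent s A = 0} = Ioi d := by
      ext s
      refine ⟨fun h => ?_, fun h => ⟨hd.trans h, hbig s h⟩⟩
      by_contra hs
      exact (hcpos.trans_le ((hsmall s (not_lt.1 hs)).trans (hle s))).ne' h.2
    rw [upperBoxDim, this, csInf_Ioi]
  · have : {s : ℝ | 0 < s ∧ lowerMinkowskiContent s A = 0} = Ioi d := by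
      ext s
      refine ⟨fun h => ?_, fun h => ⟨hd.trans h, le_antisymm ((hle s).trans (hbig s h).le)
        zero_le⟩⟩
      by_contra hs
      exact (hcpos.trans_le (hsmall s (not_lt.1 hs))).ne' h.2
    rw [lowerBoxDim, this, csInf_Ioi]
  · refine lt_of_le_of_lt (limsup_le_of_le (by isBoundedDefault) (a := ENNReal.ofReal C) ?_)
      ENNReal.ofReal_lt_top
    filter_upwards [hQu d] with ε h
    simpa using h

/-- The `ε`-neighbourhood of a Lipschitz arc has area at most proportional to
(length + `ε`) times `ε`. -/
theorem volume_thickening_image_Icc_le {E : ℝ → Plane} {a b Λ ε : ℝ} (hab : a ≤ b)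
    (hE : ∀ s ∈ Icc a b, ∀ t ∈ Icc a b, dist (E s) (E t) ≤ Λ * |s - t|) (hΛ : 0 ≤ Λ)
    (hε : 0 < ε) :
    volume (Metric.thickening ε (E '' Icc a b)) ≤
      ENNReal.ofReal (16 * (Λ * (b - a) + 2 * ε) * ε) := by
  -- Enough equal pieces for each image to have diameter at most `ε`, so balls of radius `2ε` about
  -- the images of the left endpoints cover the neighbourhood. The `+ 1` keeps `N` positive when the
  -- arc is a point.
  set N : ℕ := ⌈Λ * (b - a) / ε⌉₊ + 1 with hN
  have hNpos : (0 : ℝ) < N := by positivity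
  have hNle : (N : ℝ) ≤ Λ * (b - a) / ε + 2 := by
    have := (Nat.ceil_lt_add_one (a := Λ * (b - a) / ε)
      (div_nonneg (mul_nonneg hΛ (sub_nonneg.2 hab)) hε.le)).le
    rw [hN]; push_cast; linarith
  have hNge : Λ * (b - a) ≤ N * ε := by
    rw [← div_le_iff₀ hε]
    have := Nat.le_ceil (Λ * (b - a) / ε)
    rw [hN]; push_cast; linarith
  set p : ℕ → ℝ := fun i => a + (b - a) * i / N with hp
  have hcov : Metric.thickening ε (E '' Icc a b) ⊆
      ⋃ i ∈ Finset.range N, Metric.ball (E (p i)) (2 * ε) := by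
    intro x hx
    obtain ⟨_, ⟨t, ht, rfl⟩, hxt⟩ := Metric.mem_thickening_iff.1 hx
    simp only [mem_iUnion, Finset.mem_range, exists_prop]
    rcases hab.eq_or_lt with rfl | hlt
    · refine ⟨0, by omega, ?_⟩
      have : t = a := le_antisymm ht.2 ht.1
      subst this
      simp only [hp, Metric.mem_ball]
      simp only [sub_self, zero_mul, zero_div, add_zero]
      linarith
    have hba : 0 < b - a := sub_pos.2 hlt
    obtain ⟨i, hi, hi1, hi2⟩ : ∃ i < N, (i : ℝ) ≤ (t - a) / (b - a) * N ∧
        (t - a) / (b - a) * N ≤ i + 1 := by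
      have h0 : 0 ≤ (t - a) / (b - a) * N :=
        mul_nonneg (div_nonneg (sub_nonneg.2 ht.1) hba.le) hNpos.le
      have h1 : (t - a) / (b - a) * N ≤ N := by
        refine mul_le_of_le_one_left hNpos.le ?_
        rw [div_le_one hba]
        linarith [ht.2]
      -- The right endpoint `t = b` would get the index `N`; it is assigned to the last piece.
      rcases h1.eq_or_lt with h1 | h1
      · refine ⟨N - 1, by omega, ?_⟩
        rw [h1, Nat.cast_sub (by omega)]
        constructor <;> push_cast <;> linarith
      · refine ⟨⌊(t - a) / (b - a) * N⌋₊, (Nat.floor_lt h0).2 h1, Nat.floor_le h0,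
          (Nat.lt_floor_add_one _).le⟩
    have hta : t = a + (b - a) * ((t - a) / (b - a) * N) / N := by field_simp; ring
    have hpi : |t - p i| ≤ (b - a) / N := by
      have : t - p i = (b - a) / N * ((t - a) / (b - a) * N - i) := by
        simp only [hp]
        field_simp
        ring
      rw [this, abs_mul, abs_of_pos (by positivity)]
      refine mul_le_of_le_one_right (by positivity) ?_
      rw [abs_le]
      constructor <;> linarith
    have hpmem : p i ∈ Icc a b := by
      have hiN : (i : ℝ) ≤ N := by exact_mod_cast hi.le
      refine ⟨?_, ?_⟩
      · simp only [hp]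
        have : 0 ≤ (b - a) * i / N := by positivity
        linarith
      · simp only [hp]
        have : (b - a) * i / N ≤ b - a := by
          rw [div_le_iff₀ hNpos]
          exact mul_le_mul_of_nonneg_left hiN hba.le
        linarith
    refine ⟨i, hi, ?_⟩
    rw [Metric.mem_ball]
    have h2 := hE t ht _ hpmem
    have h3 : Λ * |t - p i| ≤ ε := by
      calc Λ * |t - p i| ≤ Λ * ((b - a) / N) := mul_le_mul_of_nonneg_left hpi hΛ
        _ = Λ * (b - a) / N := by ring
        _ ≤ ε := by rw [div_le_iff₀ hNpos]; linarith
    linarith [dist_triangle x (E t) (E (p i))]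
  calc volume (Metric.thickening ε (E '' Icc a b))
      ≤ volume (⋃ i ∈ Finset.range N, Metric.ball (E (p i)) (2 * ε)) := measure_mono hcov
    _ ≤ ∑ i ∈ Finset.range N, volume (Metric.ball (E (p i)) (2 * ε)) :=
        measure_biUnion_finset_le _ _
    _ = ENNReal.ofReal (N * (4 * ε ^ 2 * Real.pi)) := by
        simp only [EuclideanSpace.volume_ball_fin_two]
        rw [Finset.sum_const, Finset.card_range, nsmul_eq_mul,
          show (N : ℝ) * (4 * ε ^ 2 * Real.pi) = N * ((2 * ε) ^ 2 * Real.pi) by ring,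
          ENNReal.ofReal_mul (p := (N : ℝ)) (by positivity), ENNReal.ofReal_natCast,
          ENNReal.ofReal_mul (p := (2 * ε) ^ 2) (by positivity),
          ENNReal.ofReal_pow (by positivity)]
    _ ≤ ENNReal.ofReal (16 * (Λ * (b - a) + 2 * ε) * ε) := by
        refine ENNReal.ofReal_le_ofReal ?_
        have h4 : (N : ℝ) * ε ≤ Λ * (b - a) + 2 * ε := by
          have := mul_le_mul_of_nonneg_right hNle hε.le
          rwa [add_mul, div_mul_cancel₀ _ hε.ne'] at this
        have hpi := Real.pi_le_four
        calc (N : ℝ) * (4 * ε ^ 2 * Real.pi) ≤ N * (4 * ε ^ 2 * 4) := by gcongr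
          _ = 16 * (N * ε) * ε := by ring
          _ ≤ _ := by gcongr

/-! ### Neighbourhoods of spirals -/

/-- The point with polar coordinates `r`, `σ * θ`, for a sign `σ`. -/
noncomputable def spiralPoint (σ r θ : ℝ) : Plane := !₂[r * Real.cos θ, σ * (r * Real.sin θ)]

theorem norm_sq_plane (w : Plane) : ‖w‖ ^ 2 = w 0 ^ 2 + w 1 ^ 2 := by
  rw [EuclideanSpace.norm_sq_eq]; simp [Fin.sum_univ_two]

theorem dist_spiralPoint_same_angle {σ : ℝ} (hσ : σ ^ 2 = 1) (r s θ : ℝ) :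
    dist (spiralPoint σ r θ) (spiralPoint σ s θ) = |r - s| := by
  rw [dist_eq_norm, ← abs_norm, ← sq_eq_sq_iff_abs_eq_abs, norm_sq_plane]
  simp only [spiralPoint, PiLp.sub_apply, Matrix.cons_val_zero, Matrix.cons_val_one]
  linear_combination ((r - s) ^ 2 * Real.sin θ ^ 2) * hσ
    + (r - s) ^ 2 * Real.sin_sq_add_cos_sq θ

theorem spiralPoint_zero_left (σ θ : ℝ) : spiralPoint σ 0 θ = 0 := by
  ext i; fin_cases i <;> simp [spiralPoint]

theorem norm_spiralPoint {σ : ℝ} (hσ : σ ^ 2 = 1) (r θ : ℝ) : ‖spiralPoint σ r θ‖ = |r| := by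
  have := dist_spiralPoint_same_angle hσ r 0 θ
  rwa [spiralPoint_zero_left, dist_zero_right, sub_zero] at this

theorem dist_spiralPoint_same_radius_le {σ : ℝ} (hσ : σ ^ 2 = 1) (r s t : ℝ) :
    dist (spiralPoint σ r s) (spiralPoint σ r t) ≤ |r| * |s - t| := by
  rw [dist_eq_norm, ← abs_norm, ← abs_mul, ← sq_le_sq, norm_sq_plane]
  simp only [spiralPoint, PiLp.sub_apply, Matrix.cons_val_zero, Matrix.cons_val_one]
  have h1 : (r * Real.cos s - r * Real.cos t) ^ 2 + (σ * (r * Real.sin s) - σ * (r * Real.sin t)) ^ 2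
      = r ^ 2 * (2 - 2 * Real.cos (s - t)) := by
    rw [Real.cos_sub]
    linear_combination (r * Real.sin s - r * Real.sin t) ^ 2 * hσ
      + r ^ 2 * Real.sin_sq_add_cos_sq s + r ^ 2 * Real.sin_sq_add_cos_sq t
  rw [h1, mul_pow]
  refine mul_le_mul_of_nonneg_left ?_ (sq_nonneg r)
  linarith [Real.one_sub_sq_div_two_le_cos (x := s - t)]

theorem spiralPoint_add_nat_mul_two_pi (σ r θ : ℝ) (n : ℕ) :
    spiralPoint σ r (θ + n * (2 * Real.pi)) = spiralPoint σ r θ := by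
  simp [spiralPoint, Real.cos_add_nat_mul_two_pi, Real.sin_add_nat_mul_two_pi]

/-- The principal argument (of the conjugate if `σ = -1`) is shifted by one turn, because spirals
are parametrised by nonnegative angles. The bound `4π` is what two applications of
`IsPowerSpiral.le_two_mul` can reach from angle `0`. -/
theorem exists_eq_spiralPoint {σ : ℝ} (hσ : σ ^ 2 = 1) (w : Plane) :
    ∃ φ, 0 ≤ φ ∧ φ ≤ 4 * Real.pi ∧ w = spiralPoint σ ‖w‖ φ := by
  set ζ : ℂ := ⟨w 0, σ * w 1⟩ with hζ
  have hn : ‖ζ‖ = ‖w‖ := by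
    rw [← abs_norm, ← abs_norm w, ← sq_eq_sq_iff_abs_eq_abs, norm_sq_plane, Complex.sq_norm,
      Complex.normSq_apply]
    simp only [hζ]
    linear_combination w 1 ^ 2 * hσ
  refine ⟨ζ.arg + (1 : ℕ) * (2 * Real.pi), ?_, ?_, ?_⟩
  · have := Complex.neg_pi_lt_arg ζ
    push_cast
    linarith [Real.pi_pos]
  · have := Complex.arg_le_pi ζ
    push_cast
    linarith [Real.pi_pos]
  · rw [spiralPoint_add_nat_mul_two_pi, ← hn]
    have h0 : w 0 = ‖ζ‖ * Real.cos ζ.arg := (Complex.norm_mul_cos_arg ζ).symm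
    have h1 : σ * w 1 = ‖ζ‖ * Real.sin ζ.arg := (Complex.norm_mul_sin_arg ζ).symm
    ext i
    fin_cases i
    · simpa [spiralPoint] using h0
    · simp only [spiralPoint, Fin.mk_one, Matrix.cons_val_one, Fin.isValue]
      simp only [Matrix.cons_val_fin_one]
      rw [← h1]
      linear_combination (-w 1) * hσ

/-- A positive function of the angle `θ ≥ 0` that describes a spiral in polar coordinates, slowly
varying, whose turns are separated by gaps comparable to the `m`-th power of the radius. -/
structure IsPowerSpiral (ρ : ℝ → ℝ) (m : ℕ) (c C : ℝ) : Prop where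
  pos : ∀ θ, 0 ≤ θ → 0 < ρ θ
  le_two_mul : ∀ θ θ', 0 ≤ θ → 0 ≤ θ' → |θ - θ'| ≤ 2 * Real.pi → ρ θ ≤ 2 * ρ θ'
  lip : ∀ θ θ', 0 ≤ θ → 0 ≤ θ' → |θ - θ'| ≤ 2 * Real.pi → |ρ θ - ρ θ'| ≤ ρ θ * |θ - θ'|
  gap_lower : ∀ n : ℕ, c * ρ (n * (2 * Real.pi)) ^ m ≤
    ρ (n * (2 * Real.pi)) - ρ ((n + 1 : ℕ) * (2 * Real.pi))
  gap_upper : ∀ θ, 0 ≤ θ → |ρ θ - ρ (θ + 2 * Real.pi)| ≤ C * ρ θ ^ m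

namespace IsPowerSpiral

variable {ρ : ℝ → ℝ} {m : ℕ} {c C : ℝ}

/-- The radii on the section decrease, and in the limit the lower gap bound reads `c l^m ≤ 0`. -/
theorem tendsto_zero (h : IsPowerSpiral ρ m c C) (hc : 0 < c) (hm : m ≠ 0) :
    Tendsto (fun n : ℕ => ρ (n * (2 * Real.pi))) atTop (𝓝 0) := by
  set r : ℕ → ℝ := fun n => ρ (n * (2 * Real.pi)) with hr
  have hpos : ∀ n, 0 < r n := fun n => h.pos _ (by positivity)
  have hanti : Antitone r := antitone_nat_of_succ_le fun n => by
    have h1 := h.gap_lower n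
    have h2 : 0 < c * r n ^ m := mul_pos hc (pow_pos (hpos n) m)
    simp only [hr] at h2 ⊢
    linarith
  have hbdd : BddBelow (range r) := ⟨0, by rintro _ ⟨n, rfl⟩; exact (hpos n).le⟩
  have ht := tendsto_atTop_ciInf hanti hbdd
  set l := ⨅ n, r n with hl
  have h1 : Tendsto (fun n => r n - r (n + 1)) atTop (𝓝 (l - l)) :=
    ht.sub (ht.comp (tendsto_add_atTop_nat 1))
  have h2 : c * l ^ m ≤ l - l := le_of_tendsto_of_tendsto' ((ht.pow m).const_mul c) h1
    fun n => h.gap_lower n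
  have h3 : 0 ≤ l := le_ciInf fun n => (hpos n).le
  have h4 : l ^ m ≤ 0 := by
    rw [sub_self] at h2
    exact nonpos_of_mul_nonpos_right h2 hc
  have h5 : l = 0 := pow_eq_zero_iff hm |>.1 (le_antisymm h4 (pow_nonneg h3 m))
  rwa [h5] at ht

/-- Telescoping: for consecutive radii `x ≥ y`, the gap bound divided by `xy` gives `c x^(m-2) ≤ 1/y
- 1/x`. Multiplying by `x^(-(m-3))` turns this into `c x ≤ y^(-(m-2)) - x^(-(m-2))`. -/
theorem sum_le (h : IsPowerSpiral ρ m c C) (hc : 0 < c) (hm : 3 ≤ m) (M : ℕ) :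
    c * ∑ n ∈ Finset.range M, ρ (n * (2 * Real.pi)) ≤ (ρ (M * (2 * Real.pi)))⁻¹ ^ (m - 2) := by
  obtain ⟨l, rfl⟩ : ∃ l, m = l + 3 := ⟨m - 3, by omega⟩
  rw [show l + 3 - 2 = l + 1 by omega]
  induction M with
  | zero =>
    have := h.pos 0 le_rfl
    simp only [Finset.range_zero, Finset.sum_empty, mul_zero, Nat.cast_zero, zero_mul]
    positivity
  | succ M ih =>
    rw [Finset.sum_range_succ, mul_add]
    have hx : 0 < ρ (M * (2 * Real.pi)) := h.pos _ (by positivity)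
    have hy : 0 < ρ ((M + 1 : ℕ) * (2 * Real.pi)) := h.pos _ (by positivity)
    have hg := h.gap_lower M
    set x := ρ (M * (2 * Real.pi))
    set y := ρ ((M + 1 : ℕ) * (2 * Real.pi))
    have hyx : y ≤ x := by
      have : 0 < c * x ^ (l + 3) := by positivity
      linarith
    have h1 : c * x ^ (l + 1) ≤ y⁻¹ - x⁻¹ := by
      rw [inv_sub_inv hy.ne' hx.ne', le_div_iff₀ (by positivity)]
      calc c * x ^ (l + 1) * (y * x) ≤ c * x ^ (l + 1) * (x * x) := by gcongr
        _ = c * x ^ (l + 3) := by ring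
        _ ≤ x - y := hg
    have h2 : x⁻¹ ^ l * y⁻¹ ≤ y⁻¹ ^ (l + 1) := by
      rw [pow_succ]
      gcongr
    have h3 : x⁻¹ ^ l * (c * x ^ (l + 1)) = c * x := by
      rw [inv_pow, pow_succ]
      field_simp
    have h4 : x⁻¹ ^ l * (c * x ^ (l + 1)) ≤ x⁻¹ ^ l * (y⁻¹ - x⁻¹) := by gcongr
    have h5 : x⁻¹ ^ l * (y⁻¹ - x⁻¹) = x⁻¹ ^ l * y⁻¹ - x⁻¹ ^ (l + 1) := by ring
    linarith

/-- Within one turn all radii are at most twice the initial one; the radial and the angular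
displacement each contribute one factor `2`. -/
theorem dist_le (h : IsPowerSpiral ρ m c C) {σ : ℝ} (hσ : σ ^ 2 = 1) (n : ℕ) {s t : ℝ}
    (hs : s ∈ Icc (n * (2 * Real.pi)) ((n + 1 : ℕ) * (2 * Real.pi)))
    (ht : t ∈ Icc (n * (2 * Real.pi)) ((n + 1 : ℕ) * (2 * Real.pi))) :
    dist (spiralPoint σ (ρ s) s) (spiralPoint σ (ρ t) t) ≤
      (4 * ρ (n * (2 * Real.pi))) * |s - t| := by
  have hn : 0 ≤ (n : ℝ) * (2 * Real.pi) := by positivity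
  push_cast at hs ht
  have hs0 : 0 ≤ s := hn.trans hs.1
  have ht0 : 0 ≤ t := hn.trans ht.1
  have hst : |s - t| ≤ 2 * Real.pi := by
    rw [abs_le]; constructor <;> linarith [hs.1, hs.2, ht.1, ht.2]
  have hs1 : ρ s ≤ 2 * ρ (n * (2 * Real.pi)) := h.le_two_mul _ _ hs0 hn (by
    rw [abs_le]; constructor <;> linarith [hs.1, hs.2, Real.pi_pos])
  have ht1 : ρ t ≤ 2 * ρ (n * (2 * Real.pi)) := h.le_two_mul _ _ ht0 hn (by
    rw [abs_le]; constructor <;> linarith [ht.1, ht.2, Real.pi_pos])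
  calc dist (spiralPoint σ (ρ s) s) (spiralPoint σ (ρ t) t)
      ≤ dist (spiralPoint σ (ρ s) s) (spiralPoint σ (ρ t) s)
        + dist (spiralPoint σ (ρ t) s) (spiralPoint σ (ρ t) t) := dist_triangle _ _ _
    _ ≤ ρ s * |s - t| + |ρ t| * |s - t| := by
        gcongr
        · rw [dist_spiralPoint_same_angle hσ]
          exact h.lip _ _ hs0 ht0 hst
        · exact dist_spiralPoint_same_radius_le hσ _ _ _
    _ ≤ (2 * ρ (n * (2 * Real.pi))) * |s - t| + (2 * ρ (n * (2 * Real.pi))) * |s - t| := by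
        rw [abs_of_pos (h.pos t ht0)]
        gcongr
    _ = _ := by ring

theorem rpow_one_div_pow (hm : m ≠ 0) {ε : ℝ} (hε : 0 < ε) :
    (ε ^ (1 / (m : ℝ))) ^ m = ε ∧ (ε ^ (1 / (m : ℝ))) ^ 2 = ε ^ (2 / (m : ℝ)) := by
  constructor
  · rw [← Real.rpow_natCast, ← Real.rpow_mul hε.le, one_div_mul_cancel (by exact_mod_cast hm),
      Real.rpow_one]
  · rw [← Real.rpow_natCast, ← Real.rpow_mul hε.le]
    congr 1
    push_cast
    ring

/-- The disc of radius proportional to `ε ^ (1 / m)` lies in the `ε`-neighbourhood. -/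
theorem volume_thickening_ge (h : IsPowerSpiral ρ m c C) (hc : 0 < c) (hC : 0 ≤ C) (hm : 3 ≤ m)
    {σ : ℝ} (hσ : σ ^ 2 = 1) {S : Set Plane}
    (hS : ∀ θ, 0 ≤ θ → spiralPoint σ (ρ θ) θ ∈ S) :
    ∃ c' > 0, ∀ᶠ ε in 𝓝[>] (0 : ℝ),
      ENNReal.ofReal (c' * ε ^ (2 / (m : ℝ))) ≤ volume (Metric.thickening ε S) := by
  -- Chosen so that radii up to `2κR`, with `R = ε^(1/m)`, have gaps `C ρ^m` of at most `ε`.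
  set κ : ℝ := 1 / (2 * (C + 1)) with hκ
  have hκpos : 0 < κ := by positivity
  have hm0 : m ≠ 0 := by omega
  have hρ0 := h.pos 0 le_rfl
  refine ⟨Real.pi * κ ^ 2, by positivity, ?_⟩
  have hsm : ∀ᶠ ε in 𝓝[>] (0 : ℝ), κ * ε ^ (1 / (m : ℝ)) < ρ 0 / 4 := by
    have h1 := (Real.continuousAt_rpow_const 0 (1 / (m : ℝ)) (Or.inr (by positivity))).tendsto
    rw [Real.zero_rpow (by positivity)] at h1
    have h2 := (h1.const_mul κ).mono_left (nhdsWithin_le_nhds (s := Ioi 0))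
    rw [mul_zero] at h2
    exact h2.eventually_lt_const (by positivity)
  filter_upwards [hsm, self_mem_nhdsWithin] with ε hεs hε
  have hε : 0 < ε := hε
  set R := ε ^ (1 / (m : ℝ)) with hR
  have hRpos : 0 < R := Real.rpow_pos_of_pos hε _
  obtain ⟨hRm, hR2⟩ := rpow_one_div_pow hm0 hε
  have ht := h.tendsto_zero hc hm0
  have hlim : ∀ φ, 0 ≤ φ → ∀ δ > 0, ∃ n : ℕ, ρ (φ + n * (2 * Real.pi)) < δ := by
    intro φ hφ δ hδ
    obtain ⟨N, hN⟩ := eventually_atTop.1 (ht.eventually_lt_const (half_pos hδ))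
    set j := ⌈φ / (2 * Real.pi)⌉₊
    have hj1 : φ ≤ j * (2 * Real.pi) := by
      rw [← div_le_iff₀ Real.two_pi_pos]; exact Nat.le_ceil _
    have hj2 : j * (2 * Real.pi) ≤ φ + 2 * Real.pi := by
      have := (Nat.ceil_lt_add_one (div_nonneg hφ Real.two_pi_pos.le)).le
      calc j * (2 * Real.pi) ≤ (φ / (2 * Real.pi) + 1) * (2 * Real.pi) := by gcongr
        _ = φ + 2 * Real.pi := by rw [add_mul, div_mul_cancel₀ _ Real.two_pi_pos.ne', one_mul]
    refine ⟨N, ?_⟩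
    have h1 := hN (N + j) (by omega)
    have h2 := h.le_two_mul (φ + N * (2 * Real.pi)) ((N + j : ℕ) * (2 * Real.pi)) (by positivity)
      (by positivity) (by push_cast; rw [abs_le]; constructor <;> linarith [Real.pi_pos])
    linarith
  have hsub : Metric.ball (0 : Plane) (κ * R) ⊆ Metric.thickening ε S := by
    intro w hw
    rw [mem_ball_zero_iff] at hw
    rw [Metric.mem_thickening_iff]
    rcases eq_or_ne w 0 with rfl | hw0
    · obtain ⟨n, hn⟩ := hlim 0 le_rfl ε hε
      refine ⟨_, hS (0 + n * (2 * Real.pi)) (by positivity), ?_⟩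
      rw [dist_zero_left, norm_spiralPoint hσ, abs_of_pos (h.pos _ (by positivity))]
      exact hn
    have hs : 0 < ‖w‖ := norm_pos_iff.2 hw0
    obtain ⟨φ, hφ0, hφ1, hwφ⟩ := exists_eq_spiralPoint hσ w
    obtain ⟨n₀, hn₀⟩ := hlim φ hφ0 _ hs
    -- Going from angle `0` to `φ ≤ 4π` in two halves loses at most a factor `4`, hence the
    -- threshold `ρ 0 / 4`.
    have hstart : ‖w‖ ≤ ρ (φ + (0 : ℕ) * (2 * Real.pi)) := by
      have h1 := h.le_two_mul 0 (φ / 2) le_rfl (by positivity)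
        (by rw [zero_sub, abs_neg, abs_of_nonneg (by positivity)]; linarith)
      have h2 := h.le_two_mul (φ / 2) φ (by positivity) hφ0
        (by rw [abs_le]; constructor <;> linarith)
      simp only [Nat.cast_zero, zero_mul, add_zero]
      linarith
    -- On the ray through `w`, two consecutive turns enclose `w`, so its distance to the outer one
    -- is less than the gap.
    obtain ⟨n, hn1, hn2⟩ : ∃ n : ℕ, ‖w‖ ≤ ρ (φ + n * (2 * Real.pi)) ∧
        ρ (φ + (n + 1 : ℕ) * (2 * Real.pi)) < ‖w‖ := by
      by_contra! hcon
      have : ∀ n : ℕ, ‖w‖ ≤ ρ (φ + n * (2 * Real.pi)) := fun n => by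
        induction n with
        | zero => exact hstart
        | succ n ih => exact hcon n ih
      linarith [this n₀]
    set θ := φ + n * (2 * Real.pi) with hθ
    have hθ0 : 0 ≤ θ := by positivity
    have hθ' : φ + (n + 1 : ℕ) * (2 * Real.pi) = θ + 2 * Real.pi := by push_cast; ring
    rw [hθ'] at hn2
    refine ⟨_, hS θ hθ0, ?_⟩
    rw [hwφ, ← spiralPoint_add_nat_mul_two_pi σ ‖w‖ φ n, dist_spiralPoint_same_angle hσ,
      abs_sub_comm, abs_of_nonneg (by linarith)]
    have h2 : ρ θ ≤ 2 * ‖w‖ := by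
      have := h.le_two_mul θ (θ + 2 * Real.pi) hθ0 (by positivity)
        (by rw [abs_le]; constructor <;> linarith [Real.pi_pos])
      linarith
    have h3 := (le_abs_self _).trans (h.gap_upper θ hθ0)
    have h4 : ρ θ ≤ R / (C + 1) := by
      calc ρ θ ≤ 2 * (κ * R) := by linarith
        _ = R / (C + 1) := by rw [hκ]; field_simp
    calc ρ θ - ‖w‖ < ρ θ - ρ (θ + 2 * Real.pi) := by linarith
      _ ≤ C * ρ θ ^ m := h3
      _ ≤ C * (R / (C + 1)) ^ m := by
          have := (h.pos θ hθ0).le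
          gcongr
      _ = C / (C + 1) ^ m * ε := by rw [div_pow, hRm]; ring
      _ ≤ 1 * ε := by
          gcongr
          rw [div_le_one (by positivity)]
          calc C ≤ C + 1 := by linarith
            _ ≤ (C + 1) ^ m := le_self_pow₀ (by linarith) hm0
      _ = ε := one_mul ε
  refine le_trans (le_of_eq ?_) (measure_mono hsub)
  rw [EuclideanSpace.volume_ball_fin_two, ← ENNReal.ofReal_pow (by positivity),
    ← ENNReal.ofReal_mul (by positivity), ← hR2]
  congr 1
  ring

/-- Cut at the first turn `M` whose initial radius is below `R = ε^(1/m)`. Later turns, thickened,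
lie in the disc of radius `3R`. Each earlier turn costs a multiple of `ε ρ_n`, and their sum is at
most a multiple of `ε R^(-(m-2)) = R²`. The initial arc costs `O(ε)`, which is absorbed by `R²`. -/
theorem volume_thickening_le (h : IsPowerSpiral ρ m c C) (hc : 0 < c) (hm : 3 ≤ m)
    {σ : ℝ} (hσ : σ ^ 2 = 1) {S : Set Plane} {E : ℝ → Plane} {a b Λ : ℝ} (hab : a ≤ b)
    (hΛ : 0 ≤ Λ) (hE : ∀ s ∈ Icc a b, ∀ t ∈ Icc a b, dist (E s) (E t) ≤ Λ * |s - t|)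
    (hS : ∀ w ∈ S, w ∈ E '' Icc a b ∨ ∃ θ, 0 ≤ θ ∧ w = spiralPoint σ (ρ θ) θ) :
    ∃ C', ∀ᶠ ε in 𝓝[>] (0 : ℝ),
      volume (Metric.thickening ε S) ≤ ENNReal.ofReal (C' * ε ^ (2 / (m : ℝ))) := by
  have hm0 : m ≠ 0 := by omega
  refine ⟨16 * (Λ * (b - a) + 2) + 2 ^ (m - 2) * (16 * (8 * Real.pi + 2)) / c + 9 * Real.pi, ?_⟩
  filter_upwards [Ioo_mem_nhdsGT (zero_lt_one' ℝ)] with ε hε'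
  have hε : 0 < ε := hε'.1
  set R := ε ^ (1 / (m : ℝ)) with hR
  have hRpos : 0 < R := Real.rpow_pos_of_pos hε _
  obtain ⟨hRm, hR2⟩ := rpow_one_div_pow hm0 hε
  have hR1 : R ≤ 1 := Real.rpow_le_one hε.le hε'.2.le (by positivity)
  have hεR2 : ε ≤ R ^ 2 := by
    rw [← hRm]
    exact pow_le_pow_of_le_one hRpos.le hR1 (by omega)
  have hεR : ε ≤ R := hεR2.trans (by nlinarith)
  have ht := h.tendsto_zero hc hm0
  set r : ℕ → ℝ := fun n => ρ (n * (2 * Real.pi)) with hr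
  have hrpos : ∀ n, 0 < r n := fun n => h.pos _ (by positivity)
  have hanti : Antitone r := antitone_nat_of_succ_le fun n => by
    have h1 := h.gap_lower n
    have h2 : 0 < c * r n ^ m := mul_pos hc (pow_pos (hrpos n) m)
    simp only [hr] at h2 ⊢
    linarith
  obtain ⟨M, hM, hMmin⟩ : ∃ M, r M < R ∧ ∀ n < M, R ≤ r n := by
    have hex : ∃ M, r M < R := (ht.eventually_lt_const hRpos).exists
    classical
    exact ⟨Nat.find hex, Nat.find_spec hex, fun n hn => not_lt.1 (Nat.find_min hex hn)⟩
  set T : ℕ → Set Plane := fun n => (fun θ => spiralPoint σ (ρ θ) θ) ''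
    Icc (n * (2 * Real.pi)) ((n + 1 : ℕ) * (2 * Real.pi)) with hT
  have hcov : Metric.thickening ε S ⊆ Metric.thickening ε (E '' Icc a b) ∪
      ((⋃ n ∈ Finset.range M, Metric.thickening ε (T n)) ∪ Metric.ball 0 (3 * R)) := by
    intro x hx
    obtain ⟨w, hw, hxw⟩ := Metric.mem_thickening_iff.1 hx
    rcases hS w hw with hwE | ⟨θ, hθ, rfl⟩
    · exact Or.inl (Metric.mem_thickening_iff.2 ⟨w, hwE, hxw⟩)
    right
    set n := ⌊θ / (2 * Real.pi)⌋₊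
    have hn1 : n * (2 * Real.pi) ≤ θ := by
      rw [← le_div_iff₀ Real.two_pi_pos]
      exact Nat.floor_le (div_nonneg hθ Real.two_pi_pos.le)
    have hn2 : θ ≤ (n + 1 : ℕ) * (2 * Real.pi) := by
      rw [← div_le_iff₀ Real.two_pi_pos]
      push_cast
      exact (Nat.lt_floor_add_one _).le
    rcases lt_or_ge n M with hnM | hnM
    · left
      simp only [mem_iUnion, Finset.mem_range, exists_prop]
      exact ⟨n, hnM, Metric.mem_thickening_iff.2 ⟨_, ⟨θ, ⟨hn1, hn2⟩, rfl⟩, hxw⟩⟩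
    · right
      rw [mem_ball_zero_iff]
      have h1 : ρ θ ≤ 2 * r n := by
        push_cast at hn2
        exact h.le_two_mul _ _ hθ (by positivity) (by
          rw [abs_le]; constructor <;> linarith [Real.pi_pos])
      have h2 : r n ≤ r M := hanti hnM
      have h3 : ‖x‖ ≤ dist x (spiralPoint σ (ρ θ) θ) + ‖spiralPoint σ (ρ θ) θ‖ := by
        rw [dist_eq_norm]
        exact norm_le_norm_sub_add x _
      rw [norm_spiralPoint hσ, abs_of_pos (h.pos θ hθ)] at h3
      linarith
  have hturn : ∀ n ∈ Finset.range M, volume (Metric.thickening ε (T n)) ≤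
      ENNReal.ofReal (16 * (8 * Real.pi + 2) * ε * r n) := by
    intro n hn
    refine (volume_thickening_image_Icc_le (by push_cast; linarith [Real.pi_pos])
      (fun s hs t ht => h.dist_le hσ n hs ht) (by have := (hrpos n).le; positivity) hε).trans
      (ENNReal.ofReal_le_ofReal ?_)
    have h1 : ε ≤ r n := hεR.trans (hMmin n (Finset.mem_range.1 hn))
    have h2 : 4 * ρ (n * (2 * Real.pi)) * (((n + 1 : ℕ) : ℝ) * (2 * Real.pi) - n * (2 * Real.pi))
        = 8 * Real.pi * r n := by
      simp only [hr]; push_cast; ring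
    rw [h2]
    calc 16 * (8 * Real.pi * r n + 2 * ε) * ε ≤ 16 * (8 * Real.pi * r n + 2 * r n) * ε := by
          gcongr
      _ = _ := by ring
  have hsum : ∑ n ∈ Finset.range M, r n ≤ 2 ^ (m - 2) / c * R⁻¹ ^ (m - 2) := by
    rcases Nat.eq_zero_or_pos M with rfl | hMpos
    · simp only [Finset.range_zero, Finset.sum_empty]
      positivity
    have h1 := h.sum_le hc hm M
    -- Minimality of `M` bounds only `r (M - 1)` from below; one turn later at most a factor `2` is
    -- lost.
    have h2 : R ≤ 2 * r M := by
      refine (hMmin (M - 1) (by omega)).trans (h.le_two_mul _ _ (by positivity) (by positivity) ?_)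
      rw [Nat.cast_sub hMpos, abs_le]
      constructor <;> push_cast <;> linarith [Real.pi_pos]
    have h3 : (r M)⁻¹ ≤ 2 * R⁻¹ := by
      rw [← div_eq_mul_inv, inv_le_comm₀ (hrpos M) (by positivity), inv_div]
      linarith
    have h4 : (r M)⁻¹ ^ (m - 2) ≤ (2 * R⁻¹) ^ (m - 2) := by
      have := (hrpos M).le
      gcongr
    rw [mul_pow] at h4
    calc ∑ n ∈ Finset.range M, r n = (c * ∑ n ∈ Finset.range M, r n) / c := by field_simp
      _ ≤ (2 ^ (m - 2) * R⁻¹ ^ (m - 2)) / c := div_le_div_of_nonneg_right (h1.trans h4) hc.le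
      _ = _ := by ring
  have hεR' : ε * R⁻¹ ^ (m - 2) = R ^ 2 := by
    rw [inv_pow, ← div_eq_mul_inv, div_eq_iff (by positivity), ← pow_add,
      show 2 + (m - 2) = m by omega, hRm]
  have harc := volume_thickening_image_Icc_le hab hE hΛ hε
  calc volume (Metric.thickening ε S)
      ≤ volume (Metric.thickening ε (E '' Icc a b)) +
        (∑ n ∈ Finset.range M, volume (Metric.thickening ε (T n)) +
          volume (Metric.ball (0 : Plane) (3 * R))) := by
        refine (measure_mono hcov).trans ((measure_union_le _ _).trans ?_)
        gcongr
        refine (measure_union_le _ _).trans ?_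
        gcongr
        exact measure_biUnion_finset_le _ _
    _ ≤ ENNReal.ofReal (16 * (Λ * (b - a) + 2 * ε) * ε) +
        (∑ n ∈ Finset.range M, ENNReal.ofReal (16 * (8 * Real.pi + 2) * ε * r n) +
          ENNReal.ofReal (9 * Real.pi * R ^ 2)) := by
        gcongr with n hn
        · exact hturn n hn
        · rw [EuclideanSpace.volume_ball_fin_two, ← ENNReal.ofReal_pow (by positivity),
            ← ENNReal.ofReal_mul (by positivity)]
          exact le_of_eq (by congr 1; ring)
    _ = ENNReal.ofReal (16 * (Λ * (b - a) + 2 * ε) * ε +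
        (∑ n ∈ Finset.range M, 16 * (8 * Real.pi + 2) * ε * r n + 9 * Real.pi * R ^ 2)) := by
        have hn : ∀ n ∈ Finset.range M, 0 ≤ 16 * (8 * Real.pi + 2) * ε * r n := fun n _ => by
          have := (hrpos n).le
          positivity
        have hba : 0 ≤ b - a := sub_nonneg.2 hab
        rw [← ENNReal.ofReal_sum_of_nonneg hn, ← ENNReal.ofReal_add (Finset.sum_nonneg hn)
          (by positivity), ← ENNReal.ofReal_add (by positivity)
          (add_nonneg (Finset.sum_nonneg hn) (by positivity))]
    _ ≤ _ := by
        refine ENNReal.ofReal_le_ofReal ?_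
        rw [← hR2, ← Finset.mul_sum]
        have hba : 0 ≤ b - a := sub_nonneg.2 hab
        have h1 : 16 * (Λ * (b - a) + 2 * ε) * ε ≤ 16 * (Λ * (b - a) + 2) * R ^ 2 := by
          have : 2 * ε ≤ 2 := by linarith [hε'.2]
          gcongr
        have h2 : 16 * (8 * Real.pi + 2) * ε * ∑ n ∈ Finset.range M, r n ≤
            2 ^ (m - 2) * (16 * (8 * Real.pi + 2)) / c * R ^ 2 := by
          calc 16 * (8 * Real.pi + 2) * ε * ∑ n ∈ Finset.range M, r n
              ≤ 16 * (8 * Real.pi + 2) * ε * (2 ^ (m - 2) / c * R⁻¹ ^ (m - 2)) := by gcongr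
            _ = 2 ^ (m - 2) * (16 * (8 * Real.pi + 2)) / c * (ε * R⁻¹ ^ (m - 2)) := by ring
            _ = _ := by rw [hεR']
        linarith

end IsPowerSpiral

/-! ### The polar form of a perturbed rotation -/

/-- `G` is small and Lipschitz on the punctured disc of radius `δ`; the system `ζ' = ζ (i + G(ζ))`
is then close to a rotation there. -/
structure IsSmallPerturbation (G : ℂ → ℂ) (C δ : ℝ) : Prop where
  nonneg : 0 ≤ C
  pos : 0 < δ
  mul_le : C * δ ≤ 1 / 100
  norm_le : ∀ z, z ≠ 0 → ‖z‖ < δ → ‖G z‖ ≤ C * ‖z‖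
  lip : ∀ z w, z ≠ 0 → w ≠ 0 → ‖z‖ < δ → ‖w‖ < δ → ‖G z - G w‖ ≤ C * ‖z - w‖

/-- The number with polar coordinates `x`, `σ * θ`. -/
noncomputable def polarPoint (σ θ x : ℝ) : ℂ := x * Complex.exp (Complex.I * (σ * θ : ℝ))

/-- The right-hand side of `dρ/dθ = F(θ, ρ)` for the orbits of `ζ' = σ ζ (i + G(ζ))`, with
`ζ = ρ exp(i σ θ)`. -/
noncomputable def polarField (G : ℂ → ℂ) (σ θ x : ℝ) : ℝ :=
  σ * x * (G (polarPoint σ θ x)).re / (1 + (G (polarPoint σ θ x)).im)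

theorem norm_polarPoint_sub (σ θ x y : ℝ) :
    ‖polarPoint σ θ x - polarPoint σ θ y‖ = |x - y| := by
  rw [polarPoint, polarPoint, ← sub_mul, norm_mul, mul_comm Complex.I, Complex.norm_exp_ofReal_mul_I,
    mul_one, ← Complex.ofReal_sub, Complex.norm_real, Real.norm_eq_abs]

theorem norm_polarPoint (σ θ x : ℝ) : ‖polarPoint σ θ x‖ = |x| := by
  have := norm_polarPoint_sub σ θ x 0
  simpa [polarPoint] using this

theorem polarPoint_ne_zero {σ θ x : ℝ} (hx : x ≠ 0) : polarPoint σ θ x ≠ 0 := by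
  rw [← norm_ne_zero_iff, norm_polarPoint]
  exact abs_ne_zero.2 hx

theorem polarPoint_add_two_pi {σ : ℝ} (hσ : σ = 1 ∨ σ = -1) (θ x : ℝ) :
    polarPoint σ (θ + 2 * Real.pi) x = polarPoint σ θ x := by
  unfold polarPoint
  congr 1
  rcases hσ with rfl | rfl
  · rw [← Complex.exp_periodic (Complex.I * ((1 * θ : ℝ) : ℂ))]
    congr 1; push_cast; ring
  · rw [← Complex.exp_periodic.sub_eq (Complex.I * ((-1 * θ : ℝ) : ℂ))]
    congr 1; push_cast; ring

namespace IsSmallPerturbation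

variable {G : ℂ → ℂ} {C δ : ℝ}

theorem norm_le_const (hG : IsSmallPerturbation G C δ) {z : ℂ} (hz : z ≠ 0) (hzδ : ‖z‖ < δ) :
    ‖G z‖ ≤ 1 / 100 :=
  (hG.norm_le z hz hzδ).trans
    ((mul_le_mul_of_nonneg_left hzδ.le hG.nonneg).trans hG.mul_le)

/-- The numerator is at most `C x²`, and smallness of `Im G` keeps the denominator above `1/2`. -/
theorem abs_polarField_le (hG : IsSmallPerturbation G C δ) {σ : ℝ} (hσ : σ = 1 ∨ σ = -1) (θ : ℝ)
    {x : ℝ} (hx : 0 < x) (hxδ : x < δ) : |polarField G σ θ x| ≤ 2 * C * x ^ 2 := by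
  have hn : ‖polarPoint σ θ x‖ = x := by rw [norm_polarPoint, abs_of_pos hx]
  have hz := polarPoint_ne_zero (σ := σ) (θ := θ) hx.ne'
  have h1 := hG.norm_le _ hz (by rwa [hn])
  have h2 := hG.norm_le_const hz (by rwa [hn])
  rw [hn] at h1
  rw [polarField]
  set g := G (polarPoint σ θ x)
  have hre := (Complex.abs_re_le_norm g).trans h1
  have him := (Complex.abs_im_le_norm g).trans h2
  have hd : 1 / 2 ≤ 1 + g.im := by linarith [neg_abs_le g.im]
  have hσ1 : |σ| = 1 := by rcases hσ with rfl | rfl <;> simp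
  rw [abs_div, abs_mul, abs_mul, hσ1, one_mul, abs_of_pos hx, abs_of_pos (by linarith : 0 < 1 + g.im),
    div_le_iff₀ (by linarith)]
  have hC := hG.nonneg
  calc x * |g.re| ≤ x * (C * x) := by gcongr
    _ = 2 * C * x ^ 2 * (1 / 2) := by ring
    _ ≤ _ := by gcongr

/-- Over the common denominator every term of the difference carries a small factor `|G|` or `C y`,
at most `1/100`. The resulting Lipschitz constant `1` produces the factor `exp (2π)` in the Grönwall
estimate over one turn. -/
theorem abs_polarField_sub_le (hG : IsSmallPerturbation G C δ) {σ : ℝ} (hσ : σ = 1 ∨ σ = -1)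
    (θ : ℝ) {x y : ℝ} (hx : 0 < x) (hxδ : x < δ) (hy : 0 < y) (hyδ : y < δ) :
    |polarField G σ θ x - polarField G σ θ y| ≤ |x - y| := by
  have hnx : ‖polarPoint σ θ x‖ = x := by rw [norm_polarPoint, abs_of_pos hx]
  have hny : ‖polarPoint σ θ y‖ = y := by rw [norm_polarPoint, abs_of_pos hy]
  have hzx := polarPoint_ne_zero (σ := σ) (θ := θ) hx.ne'
  have hzy := polarPoint_ne_zero (σ := σ) (θ := θ) hy.ne'
  have hlip := hG.lip _ _ hzx hzy (by rwa [hnx]) (by rwa [hny])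
  have hgx := hG.norm_le_const hzx (by rwa [hnx])
  have hgy := hG.norm_le_const hzy (by rwa [hny])
  rw [norm_polarPoint_sub] at hlip
  rw [polarField, polarField]
  set g := G (polarPoint σ θ x)
  set k := G (polarPoint σ θ y)
  have hre : |g.re - k.re| ≤ C * |x - y| := by
    rw [← Complex.sub_re]; exact (Complex.abs_re_le_norm _).trans hlip
  have him : |g.im - k.im| ≤ C * |x - y| := by
    rw [← Complex.sub_im]; exact (Complex.abs_im_le_norm _).trans hlip
  have h1 := (Complex.abs_re_le_norm g).trans hgx
  have h2 := (Complex.abs_im_le_norm g).trans hgx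
  have h3 := (Complex.abs_re_le_norm k).trans hgy
  have h4 := (Complex.abs_im_le_norm k).trans hgy
  have hdg : 99 / 100 ≤ 1 + g.im := by linarith [neg_abs_le g.im]
  have hdk : 99 / 100 ≤ 1 + k.im := by linarith [neg_abs_le k.im]
  have hdk' : |1 + k.im| ≤ 2 := by rw [abs_le]; constructor <;> linarith [le_abs_self k.im]
  have hσ1 : |σ| = 1 := by rcases hσ with rfl | rfl <;> simp
  have hCy : C * y ≤ 1 / 100 := (mul_le_mul_of_nonneg_left hyδ.le hG.nonneg).trans hG.mul_le
  have hC := hG.nonneg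
  have e : σ * x * g.re / (1 + g.im) - σ * y * k.re / (1 + k.im) =
      σ * ((x - y) * (g.re * (1 + k.im)) + y * ((g.re - k.re) * (1 + k.im) - k.re * (g.im - k.im)))
        / ((1 + g.im) * (1 + k.im)) := by
    field_simp
    ring
  have hden : 98 / 100 ≤ (1 + g.im) * (1 + k.im) := by nlinarith
  rw [e, abs_div, abs_of_pos (by linarith : 0 < (1 + g.im) * (1 + k.im)),
    div_le_iff₀ (by linarith), abs_mul, hσ1, one_mul]
  have hxy := abs_nonneg (x - y)
  calc |(x - y) * (g.re * (1 + k.im)) + y * ((g.re - k.re) * (1 + k.im) - k.re * (g.im - k.im))|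
      ≤ |x - y| * (|g.re| * |1 + k.im|) + y * (|g.re - k.re| * |1 + k.im|
          + |k.re| * |g.im - k.im|) := by
        refine (abs_add_le _ _).trans ?_
        rw [abs_mul, abs_mul, abs_mul y, abs_of_pos hy]
        gcongr
        refine (abs_sub _ _).trans ?_
        rw [abs_mul, abs_mul]
    _ ≤ |x - y| * (1 / 100 * 2) + y * (C * |x - y| * 2 + 1 / 100 * (C * |x - y|)) := by
        gcongr
    _ = |x - y| * (2 / 100) + (C * y) * (|x - y| * (201 / 100)) := by ring
    _ ≤ |x - y| * (2 / 100) + 1 / 100 * (|x - y| * (201 / 100)) := by gcongr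
    _ ≤ |x - y| * (98 / 100) := by linarith
    _ ≤ _ := by gcongr

end IsSmallPerturbation

theorem exists_int_mul_two_pi_mem (a : ℝ) : ∃ n : ℤ, a ≤ n * (2 * Real.pi) ∧
    n * (2 * Real.pi) < a + 2 * Real.pi := by
  refine ⟨⌈a / (2 * Real.pi)⌉, ?_, ?_⟩
  · rw [← div_le_iff₀ Real.two_pi_pos]
    exact Int.le_ceil _
  · have := Int.ceil_lt_add_one (a / (2 * Real.pi))
    rw [← sub_lt_iff_lt_add, lt_div_iff₀ Real.two_pi_pos] at this
    linarith

/-- `ρ` solves the polar equation over the set `A` of angles, inside the disc of radius `δ`. -/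
structure IsPolarOrbit (G : ℂ → ℂ) (σ δ : ℝ) (ρ : ℝ → ℝ) (A : Set ℝ) : Prop where
  pos : ∀ θ ∈ A, 0 < ρ θ
  lt : ∀ θ ∈ A, ρ θ < δ
  deriv : ∀ θ ∈ A, HasDerivAt ρ (polarField G σ θ (ρ θ)) θ

namespace IsPolarOrbit

variable {G : ℂ → ℂ} {C δ σ : ℝ} {ρ : ℝ → ℝ} {A : Set ℝ}

theorem mono {B : Set ℝ} (h : IsPolarOrbit G σ δ ρ A) (hB : B ⊆ A) : IsPolarOrbit G σ δ ρ B :=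
  ⟨fun θ hθ => h.pos θ (hB hθ), fun θ hθ => h.lt θ (hB hθ), fun θ hθ => h.deriv θ (hB hθ)⟩

/-- Since `|ρ'| ≤ 2Cρ²`, the function `1/ρ` has derivative bounded by `2C`, uniformly down to radius
zero. -/
theorem abs_inv_sub_inv_le (h : IsPolarOrbit G σ δ ρ A) (hG : IsSmallPerturbation G C δ)
    (hσ : σ = 1 ∨ σ = -1) (hA : Convex ℝ A) {θ θ' : ℝ} (hθ : θ ∈ A) (hθ' : θ' ∈ A) :
    |(ρ θ)⁻¹ - (ρ θ')⁻¹| ≤ 2 * C * |θ - θ'| := by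
  have := hA.norm_image_sub_le_of_norm_hasDerivWithin_le (f := fun θ => (ρ θ)⁻¹) (C := 2 * C)
    (fun θ hθ => ((h.deriv θ hθ).fun_inv (h.pos θ hθ).ne').hasDerivWithinAt)
    (fun θ hθ => ?_) hθ' hθ
  · simpa [Real.norm_eq_abs] using this
  · have h1 := hG.abs_polarField_le hσ θ (h.pos θ hθ) (h.lt θ hθ)
    have hp := h.pos θ hθ
    rw [Real.norm_eq_abs, abs_div, abs_neg, abs_of_pos (by positivity : 0 < ρ θ ^ 2),
      div_le_iff₀ (by positivity)]
    exact h1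

/-- Over two turns the relative change is at most `8π C δ ≤ 8π/100 < 1/3`. -/
theorem le_mul (h : IsPolarOrbit G σ δ ρ A) (hG : IsSmallPerturbation G C δ)
    (hσ : σ = 1 ∨ σ = -1) (hA : Convex ℝ A) {θ θ' : ℝ} (hθ : θ ∈ A) (hθ' : θ' ∈ A)
    (hd : |θ - θ'| ≤ 4 * Real.pi) : ρ θ ≤ 3 / 2 * ρ θ' := by
  have h1 := h.abs_inv_sub_inv_le hG hσ hA hθ hθ'
  have hp := h.pos θ hθ
  have hp' := h.pos θ' hθ'
  have hC := hG.nonneg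
  have h2 : C * ρ θ' ≤ 1 / 100 :=
    (mul_le_mul_of_nonneg_left (h.lt θ' hθ').le hC).trans hG.mul_le
  have h3 : |(ρ θ)⁻¹ - (ρ θ')⁻¹| = |ρ θ' - ρ θ| / (ρ θ * ρ θ') := by
    rw [inv_sub_inv hp.ne' hp'.ne', abs_div, abs_of_pos (mul_pos hp hp')]
  rw [h3, div_le_iff₀ (by positivity)] at h1
  have h4 : 2 * C * |θ - θ'| * (ρ θ * ρ θ') ≤ 1 / 3 * ρ θ := by
    calc 2 * C * |θ - θ'| * (ρ θ * ρ θ') ≤ 2 * C * (4 * Real.pi) * (ρ θ * ρ θ') := by gcongr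
      _ = 8 * Real.pi * (C * ρ θ') * ρ θ := by ring
      _ ≤ 8 * 3.15 * (1 / 100) * ρ θ := by gcongr; exact Real.pi_lt_d2.le
      _ ≤ 1 / 3 * ρ θ := by gcongr; norm_num
  have := neg_abs_le (ρ θ' - ρ θ)
  linarith

theorem abs_sub_le (h : IsPolarOrbit G σ δ ρ A) (hG : IsSmallPerturbation G C δ)
    (hσ : σ = 1 ∨ σ = -1) (hA : Convex ℝ A) {θ θ' : ℝ} (hθ : θ ∈ A) (hθ' : θ' ∈ A) :
    |ρ θ - ρ θ'| ≤ ρ θ * |θ - θ'| * (2 * C * ρ θ') := by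
  have h1 := h.abs_inv_sub_inv_le hG hσ hA hθ hθ'
  have hp := h.pos θ hθ
  have hp' := h.pos θ' hθ'
  have h3 : |(ρ θ)⁻¹ - (ρ θ')⁻¹| = |ρ θ - ρ θ'| / (ρ θ * ρ θ') := by
    rw [inv_sub_inv hp.ne' hp'.ne', abs_div, abs_of_pos (mul_pos hp hp'), abs_sub_comm]
  rw [h3, div_le_iff₀ (by positivity)] at h1
  linarith

/-- Two consecutive turns stay close during one revolution. -/
theorem abs_sub_add_two_pi_le (h : IsPolarOrbit G σ δ ρ A) (hG : IsSmallPerturbation G C δ)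
    (hσ : σ = 1 ∨ σ = -1) {a : ℝ} (hA : Icc a (a + 4 * Real.pi) ⊆ A) {θ : ℝ}
    (hθ : θ ∈ Icc a (a + 2 * Real.pi)) :
    |ρ θ - ρ (θ + 2 * Real.pi)| ≤
      |ρ a - ρ (a + 2 * Real.pi)| * Real.exp (2 * Real.pi) := by
  have hpi := Real.pi_pos
  have hm1 : ∀ t ∈ Icc a (a + 2 * Real.pi), t ∈ A := fun t ht =>
    hA ⟨ht.1, by linarith [ht.2]⟩
  have hm2 : ∀ t ∈ Icc a (a + 2 * Real.pi), t + 2 * Real.pi ∈ A := fun t ht =>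
    hA ⟨by linarith [ht.1], by linarith [ht.2]⟩
  -- The polar equation is `2π`-periodic in the angle, so the next turn is another solution of the
  -- same equation and Grönwall compares the two.
  have hd : ∀ t ∈ Icc a (a + 2 * Real.pi), HasDerivAt (fun s => ρ (s + 2 * Real.pi))
      (polarField G σ t (ρ (t + 2 * Real.pi))) t := fun t ht => by
    have := (h.deriv _ (hm2 t ht)).comp_add_const t (2 * Real.pi)
    rwa [polarField, polarPoint_add_two_pi hσ] at this
  have := dist_le_of_trajectories_ODE_of_mem (v := polarField G σ) (s := fun _ => Ioo 0 δ) (K := 1)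
    (f := ρ) (g := fun s => ρ (s + 2 * Real.pi)) (a := a) (b := a + 2 * Real.pi)
    (δ := |ρ a - ρ (a + 2 * Real.pi)|)
    (fun t _ => LipschitzOnWith.of_dist_le_mul fun x hx y hy => by
      rw [Real.dist_eq, Real.dist_eq, NNReal.coe_one, one_mul]
      exact hG.abs_polarField_sub_le hσ t hx.1 hx.2 hy.1 hy.2)
    (fun t ht => (h.deriv t (hm1 t ht)).continuousAt.continuousWithinAt)
    (fun t ht => (h.deriv t (hm1 t (Ico_subset_Icc_self ht))).hasDerivWithinAt)
    (fun t ht => ⟨h.pos t (hm1 t (Ico_subset_Icc_self ht)), h.lt t (hm1 t (Ico_subset_Icc_self ht))⟩)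
    (fun t ht => (hd t ht).continuousAt.continuousWithinAt)
    (fun t ht => (hd t (Ico_subset_Icc_self ht)).hasDerivWithinAt)
    (fun t ht => ⟨h.pos _ (hm2 t (Ico_subset_Icc_self ht)), h.lt _ (hm2 t (Ico_subset_Icc_self ht))⟩)
    (by rw [Real.dist_eq]) θ hθ
  rw [Real.dist_eq, NNReal.coe_one, one_mul] at this
  refine this.trans ?_
  gcongr
  linarith [hθ.2]

/-- If the radius decreases along the section `θ ∈ 2πℤ`, the orbit stays close to the origin. -/
theorem le_three_mul (hG : IsSmallPerturbation G C δ) (hσ : σ = 1 ∨ σ = -1) {a b : ℝ}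
    (h : IsPolarOrbit G σ δ ρ (Icc a b))
    (hdec : ∀ n : ℤ, n * (2 * Real.pi) ∈ Icc a b → n * (2 * Real.pi) + 2 * Real.pi ∈ Icc a b →
      ρ (n * (2 * Real.pi) + 2 * Real.pi) ≤ ρ (n * (2 * Real.pi)))
    {θ : ℝ} (hθ : θ ∈ Icc a b) : ρ θ ≤ 3 * ρ a := by
  have hpi := Real.pi_pos
  have ha : a ∈ Icc a b := ⟨le_rfl, hθ.1.trans hθ.2⟩
  have hconv := convex_Icc (𝕜 := ℝ) a b
  have hpa := h.pos a ha
  obtain ⟨n, hn1, hn2⟩ := exists_int_mul_two_pi_mem a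
  rcases le_or_gt θ (a + 2 * Real.pi) with hle | hlt
  · have := h.le_mul hG hσ hconv hθ ha (by rw [abs_le]; constructor <;> linarith [hθ.1])
    linarith
  -- One factor `3/2` is spent on reaching the first section angle after `a`, none along the
  -- section, and another `3/2` on going from the last section angle to `θ`; the total `9/4` is
  -- below `3`.
  have hsec : ∀ j : ℕ, ((n + j : ℤ) : ℝ) * (2 * Real.pi) ≤ b →
      ρ ((n + j : ℤ) * (2 * Real.pi)) ≤ 3 / 2 * ρ a := by
    intro j
    induction j with
    | zero =>
      intro hj
      push_cast at hj ⊢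
      simp only [add_zero] at hj ⊢
      exact h.le_mul hG hσ hconv ⟨hn1, hj⟩ ha (by rw [abs_le]; constructor <;> linarith)
    | succ j ih =>
      intro hj
      have e : ((n + (j + 1 : ℕ) : ℤ) : ℝ) * (2 * Real.pi) =
          ((n + j : ℤ) : ℝ) * (2 * Real.pi) + 2 * Real.pi := by push_cast; ring
      rw [e] at hj ⊢
      have hlow : a ≤ ((n + j : ℤ) : ℝ) * (2 * Real.pi) := by
        push_cast
        have : (0 : ℝ) ≤ j * (2 * Real.pi) := by positivity
        linarith
      exact (hdec _ ⟨hlow, by linarith⟩ ⟨by linarith, hj⟩).trans (ih (by linarith))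
  set j := ⌊(θ - n * (2 * Real.pi)) / (2 * Real.pi)⌋₊
  have h0 : 0 ≤ (θ - n * (2 * Real.pi)) / (2 * Real.pi) :=
    div_nonneg (by linarith) Real.two_pi_pos.le
  have hj1 := Nat.floor_le h0
  have hj2 := Nat.lt_floor_add_one ((θ - n * (2 * Real.pi)) / (2 * Real.pi))
  rw [le_div_iff₀ Real.two_pi_pos] at hj1
  rw [div_lt_iff₀ Real.two_pi_pos] at hj2
  have e : ((n + j : ℤ) : ℝ) * (2 * Real.pi) = n * (2 * Real.pi) + j * (2 * Real.pi) := by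
    push_cast; ring
  have hjb : ((n + j : ℤ) : ℝ) * (2 * Real.pi) ≤ θ := by rw [e]; linarith
  have h1 := hsec j (hjb.trans hθ.2)
  have h2 : 0 ≤ (j : ℝ) * (2 * Real.pi) := by positivity
  have h3 := h.le_mul hG hσ hconv (θ := θ) (θ' := ((n + j : ℤ) : ℝ) * (2 * Real.pi)) hθ
    ⟨by rw [e]; linarith, hjb.trans hθ.2⟩
    (by rw [e, abs_le]; constructor <;> linarith)
  linarith

/-- An orbit that is defined for all large angles, with gaps on the section `θ ∈ 2πℤ` comparable to
the `m`-th power of the radius, is a power spiral. -/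
theorem isPowerSpiral (hG : IsSmallPerturbation G C δ) (hσ : σ = 1 ∨ σ = -1) {a : ℝ}
    (h : IsPolarOrbit G σ δ ρ (Ici a)) {m : ℕ} {c c' : ℝ} (hc : 0 < c)
    (hgap : ∀ n : ℤ, a ≤ n * (2 * Real.pi) →
      c * ρ (n * (2 * Real.pi)) ^ m ≤ ρ (n * (2 * Real.pi)) - ρ (n * (2 * Real.pi) + 2 * Real.pi) ∧
      ρ (n * (2 * Real.pi)) - ρ (n * (2 * Real.pi) + 2 * Real.pi) ≤ c' * ρ (n * (2 * Real.pi)) ^ m)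
    (n₀ : ℤ) (hn₀ : a ≤ n₀ * (2 * Real.pi)) :
    IsPowerSpiral (fun θ => ρ (θ + n₀ * (2 * Real.pi))) m c (c' * Real.exp (2 * Real.pi) * 2 ^ m) := by
  have hpi := Real.pi_pos
  have hmem : ∀ θ, 0 ≤ θ → θ + n₀ * (2 * Real.pi) ∈ Ici a := fun θ hθ => by
    rw [mem_Ici]; linarith
  have hconv := convex_Ici (𝕜 := ℝ) a
  have hsh : ∀ θ θ' : ℝ, |(θ + n₀ * (2 * Real.pi)) - (θ' + n₀ * (2 * Real.pi))| = |θ - θ'| :=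
    fun θ θ' => by congr 1; ring
  have hC := hG.nonneg
  refine ⟨fun θ hθ => h.pos _ (hmem θ hθ), fun θ θ' hθ hθ' hd => ?_, fun θ θ' hθ hθ' _ => ?_,
    fun n => ?_, fun θ hθ => ?_⟩
  · have h1 := h.le_mul hG hσ hconv (hmem θ hθ) (hmem θ' hθ') (by rw [hsh]; linarith)
    have h2 := h.pos _ (hmem θ' hθ')
    linarith
  · have h1 := h.abs_sub_le hG hσ hconv (hmem θ hθ) (hmem θ' hθ')
    rw [hsh] at h1
    refine h1.trans (mul_le_of_le_one_right ?_ ?_)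
    · exact mul_nonneg (h.pos _ (hmem θ hθ)).le (abs_nonneg _)
    · have := mul_le_mul_of_nonneg_left (h.lt _ (hmem θ' hθ')).le hC
      linarith [hG.mul_le]
  · have e1 : (n : ℝ) * (2 * Real.pi) + n₀ * (2 * Real.pi) = ((n + n₀ : ℤ) : ℝ) * (2 * Real.pi) := by
      push_cast; ring
    have e2 : ((n + 1 : ℕ) : ℝ) * (2 * Real.pi) + n₀ * (2 * Real.pi) =
        ((n + n₀ : ℤ) : ℝ) * (2 * Real.pi) + 2 * Real.pi := by
      push_cast; ring
    simp only [e1, e2]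
    refine (hgap _ ?_).1
    rw [← e1]
    have : (0 : ℝ) ≤ n * (2 * Real.pi) := by positivity
    linarith
  · set φ := θ + n₀ * (2 * Real.pi)
    obtain ⟨k, hk1, hk2⟩ := exists_int_mul_two_pi_mem (φ - 2 * Real.pi)
    have e : θ + 2 * Real.pi + n₀ * (2 * Real.pi) = φ + 2 * Real.pi := by
      simp only [φ]; ring
    simp only [e]
    have hφa : φ ∈ Ici a := hmem θ hθ
    -- The last section angle strictly before `φ` may precede the start `n₀`; in that case `n₀`
    -- itself serves.
    obtain ⟨k', hk'a, hk'1, hk'2⟩ : ∃ k' : ℤ, a ≤ k' * (2 * Real.pi) ∧ k' * (2 * Real.pi) ≤ φ ∧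
        φ ≤ k' * (2 * Real.pi) + 2 * Real.pi := by
      rcases le_or_gt n₀ k with hk | hk
      · refine ⟨k, ?_, by linarith, by linarith⟩
        have : (n₀ : ℝ) ≤ k := by exact_mod_cast hk
        have := mul_le_mul_of_nonneg_right this Real.two_pi_pos.le
        linarith
      · refine ⟨n₀, hn₀, ?_, ?_⟩
        · simp only [φ]; linarith
        · have : (k : ℝ) + 1 ≤ n₀ := by exact_mod_cast hk
          have := mul_le_mul_of_nonneg_right this Real.two_pi_pos.le
          linarith
    have h1 := h.abs_sub_add_two_pi_le hG hσ (a := k' * (2 * Real.pi))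
      (fun t ht => hk'a.trans ht.1) ⟨hk'1, hk'2⟩
    obtain ⟨g1, g2⟩ := hgap k' hk'a
    have hpk := h.pos _ (mem_Ici.2 hk'a)
    have h2 := h.le_mul hG hσ hconv (mem_Ici.2 hk'a) hφa
      (by rw [abs_le]; constructor <;> linarith)
    have hpφ := h.pos _ hφa
    have h3 : 0 < c * ρ (k' * (2 * Real.pi)) ^ m := by positivity
    rw [abs_of_pos (by linarith : 0 < ρ (k' * (2 * Real.pi)) - ρ (k' * (2 * Real.pi) + 2 * Real.pi))]
      at h1
    -- The upper gap bound dominates a positive gap, which fixes the sign of `c'`.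
    have hc' : 0 ≤ c' := by
      by_contra hneg
      have : c' * ρ (k' * (2 * Real.pi)) ^ m < 0 := mul_neg_of_neg_of_pos (not_le.1 hneg) (by positivity)
      linarith
    calc |ρ φ - ρ (φ + 2 * Real.pi)|
        ≤ c' * ρ (k' * (2 * Real.pi)) ^ m * Real.exp (2 * Real.pi) := h1.trans (by gcongr)
      _ ≤ c' * (2 * ρ φ) ^ m * Real.exp (2 * Real.pi) := by
          gcongr
          linarith
      _ = _ := by rw [mul_pow]; ring

end IsPolarOrbit

/-! ### Passing to polar coordinates along a solution -/

/-- A function whose derivative is continuous and lies in `[1/2, 2]` has a differentiable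
inverse. -/
theorem exists_inverse_of_hasDerivAt {Θ ω : ℝ → ℝ} (hΘ : ∀ t, HasDerivAt Θ (ω t) t)
    (h1 : ∀ t, 1 / 2 ≤ ω t) (h2 : ∀ t, ω t ≤ 2) :
    (∀ s t, s ≤ t → (t - s) / 2 ≤ Θ t - Θ s ∧ Θ t - Θ s ≤ 2 * (t - s)) ∧
    ∃ τ : ℝ → ℝ, (∀ t, τ (Θ t) = t) ∧ (∀ θ, Θ (τ θ) = θ) ∧ Monotone τ ∧
      ∀ θ, HasDerivAt τ (ω (τ θ))⁻¹ θ := by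
  have hb : ∀ s t, s ≤ t → (t - s) / 2 ≤ Θ t - Θ s ∧ Θ t - Θ s ≤ 2 * (t - s) := by
    intro s t hst
    constructor
    · have := mul_sub_le_image_sub_of_le_deriv (f := Θ) (fun x => (hΘ x).differentiableAt)
        (C := 1 / 2) (fun x => by rw [(hΘ x).deriv]; exact h1 x) hst
      linarith
    · exact image_sub_le_mul_sub_of_deriv_le (f := Θ) (fun x => (hΘ x).differentiableAt)
        (C := 2) (fun x => by rw [(hΘ x).deriv]; exact h2 x) hst
  refine ⟨hb, ?_⟩
  have hcont : Continuous Θ := continuous_iff_continuousAt.2 fun t => (hΘ t).continuousAt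
  have hmono : StrictMono Θ := fun s t hst => by linarith [(hb s t hst.le).1]
  have hsurj : Function.Surjective Θ := by
    refine hcont.surjective ?_ ?_
    · refine tendsto_atTop_mono' _ ?_ (tendsto_atTop_add_const_right _ (Θ 0)
        (tendsto_id.atTop_div_const (by norm_num : (0 : ℝ) < 2)))
      filter_upwards [eventually_ge_atTop 0] with t ht
      have := (hb 0 t ht).1
      simp only [id]
      linarith
    · refine tendsto_atBot_mono' _ ?_ (tendsto_atBot_add_const_right _ (Θ 0)
        (tendsto_id.atBot_div_const (by norm_num : (0 : ℝ) < 2)))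
      filter_upwards [eventually_le_atBot 0] with t ht
      have := (hb t 0 ht).1
      simp only [id]
      linarith
  set e := hmono.orderIsoOfSurjective Θ hsurj
  have he1 : ∀ t, e.symm (Θ t) = t := fun t => e.symm_apply_apply t
  have he2 : ∀ θ, Θ (e.symm θ) = θ := fun θ => e.apply_symm_apply θ
  refine ⟨e.symm, he1, he2, e.symm.monotone, fun θ => ?_⟩
  refine HasDerivAt.of_local_left_inverse (f := Θ) e.symm.continuous.continuousAt (hΘ _) ?_
    (Eventually.of_forall he2)
  linarith [h1 (e.symm θ)]

/-- Angle and logarithmic radius are obtained by integrating `1 + Im G` and `σ Re G` along the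
orbit, which avoids choosing a branch of the argument. The quotient of `ζ` by the resulting polar
expression has zero derivative, hence is constant. As the angular speed lies in `[1/2, 2]`, the
angle can replace time. The differential equation is required only on `S`, so `ζ` may be an
artificial continuation elsewhere. -/
theorem exists_polarOrbit {G : ℂ → ℂ} {C δ σ : ℝ} (hG : IsSmallPerturbation G C δ)
    (hσ : σ = 1 ∨ σ = -1) {ζ : ℝ → ℂ} (hζ : Continuous ζ) (hζ0 : ∀ t, ζ t ≠ 0)
    (hζδ : ∀ t, ‖ζ t‖ < δ) {S : Set ℝ}
    (hS : ∀ t ∈ S, HasDerivWithinAt ζ (σ * (ζ t * (Complex.I + G (ζ t)))) (Ici t) t) :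
    ∃ Θ τ ρ : ℝ → ℝ, Continuous Θ ∧
      (∀ s t, s ≤ t → (t - s) / 2 ≤ Θ t - Θ s ∧ Θ t - Θ s ≤ 2 * (t - s)) ∧
      (∀ t, τ (Θ t) = t) ∧ (∀ θ, Θ (τ θ) = θ) ∧ Monotone τ ∧
      (∀ t, 0 ≤ t → Ico 0 t ⊆ S → ζ t = polarPoint σ (Θ t) (ρ (Θ t)) ∧ ρ (Θ t) = ‖ζ t‖ ∧
        HasDerivAt ρ (polarField G σ (Θ t) (ρ (Θ t))) (Θ t)) := by
  have hgc : Continuous fun t => G (ζ t) := by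
    have hl : LipschitzOnWith (Real.toNNReal C) G {z | z ≠ 0 ∧ ‖z‖ < δ} :=
      LipschitzOnWith.of_dist_le_mul fun z hz w hw => by
        rw [dist_eq_norm, dist_eq_norm, Real.coe_toNNReal _ hG.nonneg]
        exact hG.lip z w hz.1 hw.1 hz.2 hw.2
    exact hl.continuousOn.comp_continuous hζ fun t => ⟨hζ0 t, hζδ t⟩
  have hgb : ∀ t, ‖G (ζ t)‖ ≤ 1 / 100 := fun t => hG.norm_le_const (hζ0 t) (hζδ t)
  -- Since `σ² = 1`, the phase `σ Θ` starts at `arg ζ(0)`.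
  set Θ₀ : ℝ := σ * (ζ 0).arg with hΘ₀
  set Θ : ℝ → ℝ := fun t => Θ₀ + ∫ s in (0 : ℝ)..t, (1 + (G (ζ s)).im) with hΘ
  set Λ : ℝ → ℝ := fun t => ∫ s in (0 : ℝ)..t, σ * (G (ζ s)).re with hΛ
  have hΘd : ∀ t, HasDerivAt Θ (1 + (G (ζ t)).im) t := fun t =>
    ((continuous_const.add (Complex.continuous_im.comp hgc)).integral_hasStrictDerivAt
      0 t).hasDerivAt.const_add Θ₀
  have hΛd : ∀ t, HasDerivAt Λ (σ * (G (ζ t)).re) t := fun t =>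
    ((continuous_const.mul (Complex.continuous_re.comp hgc)).integral_hasStrictDerivAt
      0 t).hasDerivAt
  have him : ∀ t, |(G (ζ t)).im| ≤ 1 / 100 := fun t =>
    (Complex.abs_im_le_norm _).trans (hgb t)
  obtain ⟨hb, τ, hτ1, hτ2, hτm, hτd⟩ := exists_inverse_of_hasDerivAt hΘd
    (fun t => by linarith [neg_abs_le (G (ζ t)).im, him t])
    (fun t => by linarith [le_abs_self (G (ζ t)).im, him t])
  set r : ℝ → ℝ := fun t => ‖ζ 0‖ * Real.exp (Λ t) with hr
  have hrd : ∀ t, HasDerivAt r (r t * (σ * (G (ζ t)).re)) t := fun t => by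
    have := ((hΛd t).exp).const_mul ‖ζ 0‖
    exact this.congr_deriv (by simp only [hr]; ring)
  have hσ2 : (σ : ℂ) * σ = 1 := by rcases hσ with rfl | rfl <;> simp
  have hpolar : ∀ t, 0 ≤ t → Ico 0 t ⊆ S → ζ t = polarPoint σ (Θ t) (r t) := by
    intro t ht hsub
    set u : ℝ → ℂ := fun s => ζ s * Complex.exp (-((Λ s : ℝ) + Complex.I * (σ * Θ s : ℝ))) with hu
    have hΘc : Continuous Θ := continuous_iff_continuousAt.2 fun t => (hΘd t).continuousAt
    have hΛc : Continuous Λ := continuous_iff_continuousAt.2 fun t => (hΛd t).continuousAt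
    have huc : Continuous u := by
      simp only [hu]
      fun_prop
    have hud : ∀ s ∈ Ico 0 t, HasDerivWithinAt u 0 (Ici s) s := by
      intro s hs
      have h1 : HasDerivAt (fun s => -(((Λ s : ℝ) : ℂ) + Complex.I * (σ * Θ s : ℝ)))
          (-(((σ * (G (ζ s)).re : ℝ) : ℂ) + Complex.I * (σ * (1 + (G (ζ s)).im) : ℝ))) s :=
        ((hΛd s).ofReal_comp.add (((hΘd s).const_mul σ).ofReal_comp.const_mul Complex.I)).neg
      have h2 := (hS s (hsub hs)).mul h1.cexp.hasDerivWithinAt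
      refine h2.congr_deriv ?_
      have h3 : G (ζ s) = (G (ζ s)).re + (G (ζ s)).im * Complex.I := (Complex.re_add_im _).symm
      push_cast
      generalize Complex.exp _ = E
      set x := (G (ζ s)).re
      set y := (G (ζ s)).im
      rw [h3]
      ring
    have hconst := constant_of_has_deriv_right_zero huc.continuousOn hud t ⟨ht, le_rfl⟩
    have hu0 : u 0 = ‖ζ 0‖ := by
      simp only [hu, hΛ, hΘ, intervalIntegral.integral_same, add_zero, hΘ₀]
      have h4 := Complex.norm_mul_exp_arg_mul_I (ζ 0)
      nth_rewrite 1 [← h4]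
      rw [mul_assoc, ← Complex.exp_add]
      push_cast
      rw [show (ζ 0).arg * Complex.I + -(0 + Complex.I * (σ * (σ * (ζ 0).arg))) = 0 by
        linear_combination (-Complex.I * (ζ 0).arg) * hσ2]
      simp
    rw [hu0] at hconst
    simp only [hu] at hconst
    rw [polarPoint]
    simp only [hr]
    rw [Complex.ofReal_mul, ← hconst, Complex.ofReal_exp, mul_assoc, mul_assoc, ← Complex.exp_add,
      ← Complex.exp_add]
    simp
  have hrpos : ∀ t, 0 < r t := fun t => mul_pos (norm_pos_iff.2 (hζ0 0)) (Real.exp_pos _)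
  refine ⟨Θ, τ, fun θ => r (τ θ), continuous_iff_continuousAt.2 fun t => (hΘd t).continuousAt,
    hb, hτ1, hτ2, hτm, fun t ht hsub => ?_⟩
  have hp := hpolar t ht hsub
  simp only [hτ1]
  refine ⟨hp, ?_, ?_⟩
  · rw [hp, norm_polarPoint, abs_of_pos (hrpos t)]
  · have h1 : HasDerivAt (fun θ => r (τ θ)) _ (Θ t) := (hrd (τ (Θ t))).comp (Θ t) (hτd (Θ t))
    refine h1.congr_deriv ?_
    rw [hτ1, polarField, ← hp]
    ring

/-! ### Orbits of perturbed rotations near the origin -/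

/-- `ζ` solves `ζ' = σ ζ (i + G(ζ))` on `I` and avoids the origin. -/
structure IsComplexOrbit (G : ℂ → ℂ) (σ : ℝ) (ζ : ℝ → ℂ) (I : Set ℝ) : Prop where
  ne_zero : ∀ t ∈ I, ζ t ≠ 0
  deriv : ∀ t ∈ I, HasDerivWithinAt ζ (σ * (ζ t * (Complex.I + G (ζ t)))) I t

/-- Inside the disc of radius `δ`, `f` is the displacement function of `ζ' = ζ (i + G(ζ))` on the
positive real axis. -/
def IsDisplacement (G : ℂ → ℂ) (δ : ℝ) (f : ℝ → ℝ) : Prop :=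
  ∀ (γ : ℝ → ℂ) (T r s : ℝ), 0 < T → IsComplexOrbit G 1 γ (Icc 0 T) →
    (∀ t ∈ Icc 0 T, ‖γ t‖ < δ) → 0 < r → 0 < s → γ 0 = r → γ T = s →
    (∀ t ∈ Ioo 0 T, ¬ (0 < (γ t).re ∧ (γ t).im = 0)) → f r = s - r

namespace IsComplexOrbit

variable {G : ℂ → ℂ} {σ : ℝ} {ζ : ℝ → ℂ} {I : Set ℝ}

theorem mono (h : IsComplexOrbit G σ ζ I) {J : Set ℝ} (hJ : J ⊆ I) : IsComplexOrbit G σ ζ J :=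
  ⟨fun t ht => h.ne_zero t (hJ ht), fun t ht => (h.deriv t (hJ ht)).mono hJ⟩

theorem continuousOn (h : IsComplexOrbit G σ ζ I) : ContinuousOn ζ I :=
  fun t ht => (h.deriv t ht).continuousWithinAt

/-- Used with `κ = 1` to restart an orbit and with `κ = -1` to reverse it, which flips `σ`. -/
theorem comp_affine (h : IsComplexOrbit G σ ζ I) {κ b : ℝ} {J : Set ℝ}
    (hJ : MapsTo (fun t => b + κ * t) J I) :
    IsComplexOrbit G (κ * σ) (fun t => ζ (b + κ * t)) J := by
  refine ⟨fun t ht => h.ne_zero _ (hJ ht), fun t ht => ?_⟩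
  have h1 : HasDerivWithinAt (fun t => b + κ * t) κ J t := by
    simpa using (((hasDerivAt_id t).const_mul κ).const_add b).hasDerivWithinAt
  have h2 := (h.deriv _ (hJ ht)).scomp t h1 hJ
  refine h2.congr_deriv ?_
  rw [Complex.real_smul]
  push_cast
  ring

end IsComplexOrbit

theorem polarPoint_re (σ θ x : ℝ) : (polarPoint σ θ x).re = x * Real.cos (σ * θ) := by
  rw [polarPoint, Complex.re_ofReal_mul, mul_comm Complex.I, Complex.exp_ofReal_mul_I_re]

theorem polarPoint_im (σ θ x : ℝ) : (polarPoint σ θ x).im = x * Real.sin (σ * θ) := by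
  rw [polarPoint, Complex.im_ofReal_mul, mul_comm Complex.I, Complex.exp_ofReal_mul_I_im]

theorem polarPoint_int_mul_two_pi {σ : ℝ} (hσ : σ = 1 ∨ σ = -1) (n : ℤ) (x : ℝ) :
    polarPoint σ (n * (2 * Real.pi)) x = x := by
  rcases hσ with rfl | rfl
  · refine Complex.ext ?_ ?_
    · simp [polarPoint_re, Real.cos_int_mul_two_pi]
    · have : Real.sin (n * (2 * Real.pi)) = 0 := by
        have := Real.sin_int_mul_pi (n * 2); push_cast at this; rwa [mul_assoc] at this
      simp [polarPoint_im, this]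
  · refine Complex.ext ?_ ?_
    · simp [polarPoint_re, Real.cos_int_mul_two_pi]
    · have : Real.sin (n * (2 * Real.pi)) = 0 := by
        have := Real.sin_int_mul_pi (n * 2); push_cast at this; rwa [mul_assoc] at this
      simp [polarPoint_im, this]

/-- On the positive axis the cosine of the angle is `1`. This certifies that the turn between
consecutive section angles ends in the first return. -/
theorem polarPoint_not_mem_positive_axis {σ : ℝ} (hσ : σ = 1 ∨ σ = -1) {n : ℤ} {θ x : ℝ}
    (hx : 0 < x) (h1 : n * (2 * Real.pi) < θ) (h2 : θ < n * (2 * Real.pi) + 2 * Real.pi) :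
    ¬ (0 < (polarPoint σ θ x).re ∧ (polarPoint σ θ x).im = 0) := by
  rintro ⟨hre, him⟩
  rw [polarPoint_re] at hre
  rw [polarPoint_im] at him
  have hcos : Real.cos (σ * θ) = Real.cos θ := by
    rcases hσ with rfl | rfl <;> simp
  have hsin : Real.sin θ ^ 2 = Real.sin (σ * θ) ^ 2 := by
    rcases hσ with rfl | rfl <;> simp
  rw [(mul_eq_zero.1 him).resolve_left hx.ne'] at hsin
  rw [hcos] at hre
  have hc : 0 < Real.cos θ := pos_of_mul_pos_right hre hx.le
  have hc1 : Real.cos θ = 1 := by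
    nlinarith [Real.sin_sq_add_cos_sq θ]
  obtain ⟨k, rfl⟩ := (Real.cos_eq_one_iff θ).1 hc1
  have h3 : n < k := by
    exact_mod_cast lt_of_mul_lt_mul_right h1 Real.two_pi_pos.le
  have h4 : k < n + 1 := by
    have : (k : ℝ) * (2 * Real.pi) < (n + 1) * (2 * Real.pi) := by linarith
    exact_mod_cast lt_of_mul_lt_mul_right this Real.two_pi_pos.le
  omega

/-- The polar form of an orbit on an interval `I` starting at `0`, onto which `ℝ` retracts. -/
theorem IsComplexOrbit.exists_polar {G : ℂ → ℂ} {C δ σ : ℝ} (hG : IsSmallPerturbation G C δ)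
    (hσ : σ = 1 ∨ σ = -1) {ζ : ℝ → ℂ} {I : Set ℝ} (h : IsComplexOrbit G σ ζ I)
    (hδ : ∀ t ∈ I, ‖ζ t‖ < δ) {p : ℝ → ℝ} (hp : Continuous p) (hpI : ∀ t, p t ∈ I)
    (hpid : ∀ t ∈ I, p t = t) (hI0 : ∀ t ∈ I, 0 ≤ t)
    (hI : ∀ t ∈ I, ∀ s ∈ Ico 0 t, s ∈ I ∧ I ∈ 𝓝[≥] s) (hIc : I.OrdConnected) :
    ∃ Θ τ ρ : ℝ → ℝ, Continuous Θ ∧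
      (∀ s t, s ≤ t → (t - s) / 2 ≤ Θ t - Θ s ∧ Θ t - Θ s ≤ 2 * (t - s)) ∧
      (∀ t, τ (Θ t) = t) ∧ (∀ θ, Θ (τ θ) = θ) ∧
      (∀ t ∈ I, ζ t = polarPoint σ (Θ t) (ρ (Θ t)) ∧ ρ (Θ t) = ‖ζ t‖) ∧
      IsPolarOrbit G σ δ ρ (Θ '' I) ∧ Convex ℝ (Θ '' I) ∧
      ∀ f, IsDisplacement G δ f → ∀ n : ℤ, n * (2 * Real.pi) ∈ Θ '' I →
        n * (2 * Real.pi) + 2 * Real.pi ∈ Θ '' I →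
        (σ = 1 ∧ f (ρ (n * (2 * Real.pi))) =
          ρ (n * (2 * Real.pi) + 2 * Real.pi) - ρ (n * (2 * Real.pi))) ∨
        (σ = -1 ∧ f (ρ (n * (2 * Real.pi) + 2 * Real.pi)) =
          ρ (n * (2 * Real.pi)) - ρ (n * (2 * Real.pi) + 2 * Real.pi)) := by
  set S : Set ℝ := {s | s ∈ I ∧ I ∈ 𝓝[≥] s} with hS
  -- Composition with the retraction `p` extends the orbit continuously to all times, within the
  -- disc and off the origin.
  obtain ⟨Θ, τ, ρ, hΘc, hb, hτ1, hτ2, -, hpol⟩ := exists_polarOrbit (ζ := fun t => ζ (p t)) (S := S)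
    hG hσ (h.continuousOn.comp_continuous hp hpI) (fun t => h.ne_zero _ (hpI t))
    (fun t => hδ _ (hpI t)) (fun s hs => by
      have h1 := (h.deriv s hs.1).mono_of_mem_nhdsWithin hs.2
      rw [hpid s hs.1]
      refine h1.congr_of_eventuallyEq ?_ (by rw [hpid s hs.1])
      filter_upwards [hs.2] with t ht
      rw [hpid t ht])
  have hpol' : ∀ t ∈ I, ζ t = polarPoint σ (Θ t) (ρ (Θ t)) ∧ ρ (Θ t) = ‖ζ t‖ ∧
      HasDerivAt ρ (polarField G σ (Θ t) (ρ (Θ t))) (Θ t) := fun t ht => by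
    have := hpol t (hI0 t ht) fun s hs => hI t ht s hs
    simpa only [hpid t ht] using this
  have hmono : StrictMono Θ := fun s t hst => by linarith [(hb s t hst.le).1]
  have horb : IsPolarOrbit G σ δ ρ (Θ '' I) := by
    refine ⟨?_, ?_, ?_⟩
    · rintro _ ⟨t, ht, rfl⟩
      rw [(hpol' t ht).2.1]
      exact norm_pos_iff.2 (h.ne_zero t ht)
    · rintro _ ⟨t, ht, rfl⟩
      rw [(hpol' t ht).2.1]
      exact hδ t ht
    · rintro _ ⟨t, ht, rfl⟩
      exact (hpol' t ht).2.2
  refine ⟨Θ, τ, ρ, hΘc, hb, hτ1, hτ2, fun t ht => ⟨(hpol' t ht).1, (hpol' t ht).2.1⟩, horb, ?_, ?_⟩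
  · have : IsPreconnected (Θ '' I) :=
      (isPreconnected_iff_ordConnected.2 hIc).image Θ hΘc.continuousOn
    exact this.ordConnected.convex
  · rintro f hf n hn1 hn2
    have hp1 := horb.pos _ hn1
    have hp2 := horb.pos _ hn2
    obtain ⟨t₁, ht₁, he1⟩ := hn1
    obtain ⟨t₂, ht₂, he2⟩ := hn2
    have hlt : t₁ < t₂ := hmono.lt_iff_lt.1 (by rw [he1, he2]; linarith [Real.pi_pos])
    have hz1 : ζ t₁ = (ρ (n * (2 * Real.pi)) : ℂ) := by
      rw [(hpol' t₁ ht₁).1, he1, polarPoint_int_mul_two_pi hσ]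
    have hz2 : ζ t₂ = (ρ (n * (2 * Real.pi) + 2 * Real.pi) : ℂ) := by
      rw [(hpol' t₂ ht₂).1, he2, polarPoint_add_two_pi hσ, polarPoint_int_mul_two_pi hσ]
    have hcross : ∀ t, t₁ < t → t < t₂ → ¬ (0 < (ζ t).re ∧ (ζ t).im = 0) := by
      intro t h1 h2
      have ht : t ∈ I := hIc.out ht₁ ht₂ ⟨h1.le, h2.le⟩
      rw [(hpol' t ht).1]
      refine polarPoint_not_mem_positive_axis hσ (n := n) (horb.pos _ ⟨t, ht, rfl⟩) ?_ ?_
      · rw [← he1]; exact hmono h1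
      · rw [← he2]; exact hmono h2
    rcases hσ with rfl | rfl
    · refine Or.inl ⟨rfl, ?_⟩
      have hmaps : MapsTo (fun t => t₁ + 1 * t) (Icc 0 (t₂ - t₁)) I := fun t ht =>
        hIc.out ht₁ ht₂ ⟨by linarith [ht.1], by linarith [ht.2]⟩
      have horb1 := h.comp_affine hmaps
      rw [one_mul] at horb1
      refine hf _ (t₂ - t₁) _ _ (sub_pos.2 hlt) horb1
        (fun t ht => hδ _ (hmaps ht)) hp1 hp2 ?_ ?_ fun t ht => hcross _ ?_ ?_
      · simpa using hz1
      · simpa using hz2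
      · linarith [ht.1]
      · linarith [ht.2]
    -- For `σ = -1` the positively oriented return runs backwards in time, so the displacement is
    -- evaluated at the radius with the larger angle.
    · refine Or.inr ⟨rfl, ?_⟩
      have hmaps : MapsTo (fun t => t₂ + -1 * t) (Icc 0 (t₂ - t₁)) I := fun t ht =>
        hIc.out ht₁ ht₂ ⟨by linarith [ht.2], by linarith [ht.1]⟩
      have horb1 := h.comp_affine hmaps
      rw [show (-1 : ℝ) * -1 = 1 by norm_num] at horb1
      refine hf _ (t₂ - t₁) _ _ (sub_pos.2 hlt) horb1
        (fun t ht => hδ _ (hmaps ht)) hp2 hp1 ?_ ?_ fun t ht => hcross _ ?_ ?_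
      · simpa using hz2
      · simpa using hz1
      · linarith [ht.2]
      · linarith [ht.1]

theorem Icc_mem_nhdsGE_of_lt {T t s : ℝ} (ht : t ∈ Icc 0 T) (hs : s ∈ Ico 0 t) :
    s ∈ Icc 0 T ∧ Icc 0 T ∈ 𝓝[≥] s := by
  refine ⟨⟨hs.1, hs.2.le.trans ht.2⟩, ?_⟩
  exact mem_of_superset (Icc_mem_nhdsGE hs.2) (Icc_subset_Icc hs.1 ht.2)

/-- A continuous quantity that satisfies an a priori bound as long as it is below `δ` stays below
`δ`. -/
theorem le_of_bootstrap {N : ℝ → ℝ} {T M δ : ℝ} (hN : ContinuousOn N (Icc 0 T)) (h0 : N 0 < δ)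
    (hM : M < δ) (h : ∀ t ∈ Icc 0 T, (∀ s ∈ Icc 0 t, N s < δ) → N t ≤ M) :
    ∀ t ∈ Icc 0 T, N t ≤ M := by
  suffices hlt : ∀ t ∈ Icc 0 T, N t < δ from fun t ht =>
    h t ht fun s hs => hlt s ⟨hs.1, hs.2.trans ht.2⟩
  by_contra! hcon
  obtain ⟨t₀, ht₀, hle⟩ := hcon
  -- At the first time when `N ≥ μ` one has `N = μ < δ`, so the hypothesis applies there and yields
  -- `N ≤ M < μ`, a contradiction.
  obtain ⟨μ, hμ1, hμ2⟩ := exists_between (max_lt h0 hM)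
  have hK : IsCompact (Icc 0 T ∩ N ⁻¹' Ici μ) :=
    isCompact_Icc.of_isClosed_subset (hN.preimage_isClosed_of_isClosed isClosed_Icc isClosed_Ici)
      inter_subset_left
  obtain ⟨t, ⟨htI, htμ⟩, hmin⟩ := hK.exists_isLeast ⟨t₀, ht₀, hμ2.le.trans hle⟩
  have hsub : Icc 0 t ⊆ Icc 0 T := Icc_subset_Icc_right htI.2
  obtain ⟨s, hs, hsμ⟩ := intermediate_value_Icc htI.1 (hN.mono hsub)
    ⟨((le_max_left _ _).trans_lt hμ1).le, htμ⟩
  have hts : t ≤ s := hmin ⟨hsub hs, hsμ.ge⟩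
  have hst : s = t := le_antisymm hs.2 hts
  rw [hst] at hsμ
  have : N t ≤ M := h t htI fun u hu => by
    rcases hu.2.eq_or_lt with rfl | hut
    · rw [hsμ]; exact hμ2
    · by_contra hu'
      exact (hmin ⟨hsub hu, hμ2.le.trans (not_lt.1 hu')⟩).not_gt hut
  linarith [(le_max_right (N 0) M).trans_lt hμ1]

/-- The gaps on the section, for the time direction in which `f` pushes orbits inwards. -/
theorem gap_bounds_of_displacement {f ρ : ℝ → ℝ} {σ δ c c' : ℝ} {m : ℕ} (hc : 0 < c) (hc' : 0 ≤ c')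
    (hf : ∀ r, 0 < r → r < δ → c * r ^ m ≤ -σ * f r ∧ -σ * f r ≤ c' * r ^ m) {θ θ' : ℝ}
    (hθ : 0 < ρ θ) (hθδ : ρ θ < δ) (hθ' : 0 < ρ θ') (hθδ' : ρ θ' < δ)
    (h1 : ρ θ ≤ 3 / 2 * ρ θ') (h2 : ρ θ' ≤ 3 / 2 * ρ θ)
    (h : (σ = 1 ∧ f (ρ θ) = ρ θ' - ρ θ) ∨ (σ = -1 ∧ f (ρ θ') = ρ θ - ρ θ')) :
    (c * (2 / 3) ^ m) * ρ θ ^ m ≤ ρ θ - ρ θ' ∧ ρ θ - ρ θ' ≤ (c' * (3 / 2) ^ m) * ρ θ ^ m := by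
  rcases h with ⟨rfl, h⟩ | ⟨rfl, h⟩
  · obtain ⟨g1, g2⟩ := hf _ hθ hθδ
    have h3 : (2 / 3 : ℝ) ^ m ≤ 1 := pow_le_one₀ (by norm_num) (by norm_num)
    have h4 : 1 ≤ (3 / 2 : ℝ) ^ m := one_le_pow₀ (by norm_num)
    constructor
    · calc c * (2 / 3) ^ m * ρ θ ^ m ≤ c * 1 * ρ θ ^ m := by gcongr
        _ ≤ _ := by linarith
    · calc ρ θ - ρ θ' ≤ c' * 1 * ρ θ ^ m := by linarith
        _ ≤ _ := by gcongr
  -- Here `f` is known at the inner radius; the ratio bounds `h1`, `h2` convert powers of `ρ θ'`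
  -- into powers of `ρ θ`.
  · obtain ⟨g1, g2⟩ := hf _ hθ' hθδ'
    constructor
    · calc c * (2 / 3) ^ m * ρ θ ^ m = c * (2 / 3 * ρ θ) ^ m := by rw [mul_pow]; ring
        _ ≤ c * ρ θ' ^ m := by gcongr; linarith
        _ ≤ _ := by linarith
    · calc ρ θ - ρ θ' ≤ c' * ρ θ' ^ m := by linarith
        _ ≤ c' * (3 / 2 * ρ θ) ^ m := by gcongr
        _ = _ := by rw [mul_pow]; ring

/-- Stability in the time direction in which `f` pushes orbits inwards. -/
theorem IsComplexOrbit.norm_le_three_mul {G : ℂ → ℂ} {C δ σ : ℝ} (hG : IsSmallPerturbation G C δ)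
    (hσ : σ = 1 ∨ σ = -1) {f : ℝ → ℝ} (hf : IsDisplacement G δ f)
    (hfs : ∀ r, 0 < r → r < δ → 0 ≤ -σ * f r) {ζ : ℝ → ℂ} {T : ℝ}
    (h : IsComplexOrbit G σ ζ (Icc 0 T)) (h0 : ‖ζ 0‖ < δ / 4) :
    ∀ t ∈ Icc 0 T, ‖ζ t‖ ≤ 3 * ‖ζ 0‖ := by
  -- The polar form is available only while the orbit stays in the disc, and there it gives the
  -- bound `3‖ζ 0‖ < δ`; the bootstrap closes this circle.
  refine le_of_bootstrap h.continuousOn.norm (δ := δ) (by linarith [hG.pos])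
    (by linarith [hG.pos]) fun T' hT' hsub => ?_
  have h' := h.mono (Icc_subset_Icc_right hT'.2)
  have hT'0 := hT'.1
  obtain ⟨Θ, τ, ρ, hΘc, hb, hτ1, hτ2, hpol, horb, hconv, hdisp⟩ := h'.exists_polar hG hσ hsub
    (p := fun t => max 0 (min t T')) (by fun_prop)
    (fun t => ⟨le_max_left _ _, max_le hT'0 (min_le_right _ _)⟩)
    (fun t ht => by rw [min_eq_left ht.2, max_eq_right ht.1]) (fun t ht => ht.1)
    (fun t ht s hs => Icc_mem_nhdsGE_of_lt ht hs) ordConnected_Icc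
  have hΘm : ∀ s t, s ≤ t → Θ s ≤ Θ t := fun s t hst => by linarith [(hb s t hst).1]
  have himg : Θ '' Icc 0 T' = Icc (Θ 0) (Θ T') := by
    refine Subset.antisymm ?_ (intermediate_value_Icc hT'0 hΘc.continuousOn)
    rintro _ ⟨t, ht, rfl⟩
    exact ⟨hΘm _ _ ht.1, hΘm _ _ ht.2⟩
  have h0mem : (0 : ℝ) ∈ Icc 0 T' := ⟨le_rfl, hT'0⟩
  have hTmem : T' ∈ Icc 0 T' := ⟨hT'0, le_rfl⟩
  rw [← (hpol T' hTmem).2, ← (hpol 0 h0mem).2]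
  rw [himg] at horb hdisp
  refine horb.le_three_mul hG hσ (fun n hn1 hn2 => ?_) ⟨hΘm _ _ hT'0, le_rfl⟩
  rcases hdisp f hf n hn1 hn2 with ⟨rfl, he⟩ | ⟨rfl, he⟩
  · have := hfs _ (horb.pos _ hn1) (horb.lt _ hn1)
    linarith
  · have := hfs _ (horb.pos _ hn2) (horb.lt _ hn2)
    linarith

/-- An orbit that starts near the origin and exists for a while yields a point at which the
displacement is quadratically small. -/
theorem IsComplexOrbit.exists_displacement_le {G : ℂ → ℂ} {C δ σ : ℝ}
    (hG : IsSmallPerturbation G C δ) (hσ : σ = 1 ∨ σ = -1) {f : ℝ → ℝ} (hf : IsDisplacement G δ f)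
    {ζ : ℝ → ℂ} (h : IsComplexOrbit G σ ζ (Icc 0 26)) (h0 : ‖ζ 0‖ < δ / 4) :
    ∃ r, 0 < r ∧ r ≤ 2 * ‖ζ 0‖ ∧ |f r| ≤ (6 * Real.pi * C) * r ^ 2 := by
  have hpi := Real.pi_pos
  have hpi2 := Real.pi_lt_d2
  have hCn := hG.nonneg
  -- No sign of `f` is known here, so confinement comes from the short time instead: the angle grows
  -- by at most `52`, and `52 · 2C‖ζ 0‖ ≤ 1/2` keeps the radius below twice its initial value.
  have hmain : ∀ T' ∈ Icc (0 : ℝ) 26, (∀ s ∈ Icc 0 T', ‖ζ s‖ < δ) → ∃ Θ ρ : ℝ → ℝ,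
      IsPolarOrbit G σ δ ρ (Icc (Θ 0) (Θ T')) ∧ T' / 2 ≤ Θ T' - Θ 0 ∧ ρ (Θ T') = ‖ζ T'‖ ∧
      (∀ θ ∈ Icc (Θ 0) (Θ T'), ρ θ ≤ 2 * ‖ζ 0‖) ∧
      ∀ n : ℤ, n * (2 * Real.pi) ∈ Icc (Θ 0) (Θ T') →
        n * (2 * Real.pi) + 2 * Real.pi ∈ Icc (Θ 0) (Θ T') →
        (σ = 1 ∧ f (ρ (n * (2 * Real.pi))) =
          ρ (n * (2 * Real.pi) + 2 * Real.pi) - ρ (n * (2 * Real.pi))) ∨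
        (σ = -1 ∧ f (ρ (n * (2 * Real.pi) + 2 * Real.pi)) =
          ρ (n * (2 * Real.pi)) - ρ (n * (2 * Real.pi) + 2 * Real.pi)) := by
    intro T' hT' hsub
    have h' := h.mono (Icc_subset_Icc_right hT'.2)
    have hT'0 := hT'.1
    obtain ⟨Θ, τ, ρ, hΘc, hb, hτ1, hτ2, hpol, horb, hconv, hdisp⟩ := h'.exists_polar hG hσ hsub
      (p := fun t => max 0 (min t T')) (by fun_prop)
      (fun t => ⟨le_max_left _ _, max_le hT'0 (min_le_right _ _)⟩)
      (fun t ht => by rw [min_eq_left ht.2, max_eq_right ht.1]) (fun t ht => ht.1)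
      (fun t ht s hs => Icc_mem_nhdsGE_of_lt ht hs) ordConnected_Icc
    have hΘm : ∀ s t, s ≤ t → Θ s ≤ Θ t := fun s t hst => by linarith [(hb s t hst).1]
    have himg : Θ '' Icc 0 T' = Icc (Θ 0) (Θ T') := by
      refine Subset.antisymm ?_ (intermediate_value_Icc hT'0 hΘc.continuousOn)
      rintro _ ⟨t, ht, rfl⟩
      exact ⟨hΘm _ _ ht.1, hΘm _ _ ht.2⟩
    have h0mem : (0 : ℝ) ∈ Icc 0 T' := ⟨le_rfl, hT'0⟩
    rw [himg] at horb hdisp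
    have hΘ0 : Θ 0 ∈ Icc (Θ 0) (Θ T') := ⟨le_rfl, hΘm _ _ hT'0⟩
    refine ⟨Θ, ρ, horb, by linarith [(hb 0 T' hT'0).1], (hpol T' ⟨hT'0, le_rfl⟩).2,
      fun θ hθ => ?_, hdisp f hf⟩
    have h1 := horb.abs_sub_le hG hσ (convex_Icc _ _) hθ hΘ0
    have h2 : |θ - Θ 0| ≤ 52 := by
      rw [abs_le]
      constructor <;> linarith [hθ.1, hθ.2, (hb 0 T' hT'0).2, hT'.2]
    have h3 : C * ‖ζ 0‖ ≤ 1 / 400 := by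
      have := mul_le_mul_of_nonneg_left h0.le hCn
      linarith [hG.mul_le]
    rw [(hpol 0 h0mem).2] at h1
    have hp := horb.pos θ hθ
    have h4 : ρ θ * |θ - Θ 0| * (2 * C * ‖ζ 0‖) ≤ 1 / 2 * ρ θ := by
      calc ρ θ * |θ - Θ 0| * (2 * C * ‖ζ 0‖) = ρ θ * |θ - Θ 0| * (2 * (C * ‖ζ 0‖)) := by ring
        _ ≤ ρ θ * 52 * (2 * (1 / 400)) := by gcongr
        _ ≤ 1 / 2 * ρ θ := by linarith
    linarith [le_abs_self (ρ θ - ‖ζ 0‖)]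
  have hstay : ∀ t ∈ Icc (0 : ℝ) 26, ‖ζ t‖ ≤ 2 * ‖ζ 0‖ := by
    refine le_of_bootstrap h.continuousOn.norm (δ := δ) (by linarith [hG.pos])
      (by linarith [hG.pos]) fun T' hT' hsub => ?_
    obtain ⟨Θ, ρ, -, hT2, he, hle, -⟩ := hmain T' hT' hsub
    rw [← he]
    exact hle _ ⟨by linarith [hT'.1], le_rfl⟩
  -- In time `26` the angle grows by at least `13 > 4π`, which leaves room for a complete turn
  -- between two section angles.
  obtain ⟨Θ, ρ, horb, hT2, -, hle, hdisp⟩ := hmain 26 ⟨by norm_num, le_rfl⟩ fun s hs => by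
    linarith [hstay s hs, hG.pos]
  obtain ⟨n, hn1, hn2⟩ := exists_int_mul_two_pi_mem (Θ 0)
  have hm1 : n * (2 * Real.pi) ∈ Icc (Θ 0) (Θ 26) := ⟨hn1, by linarith⟩
  have hm2 : n * (2 * Real.pi) + 2 * Real.pi ∈ Icc (Θ 0) (Θ 26) := ⟨by linarith, by linarith⟩
  have hconv := convex_Icc (𝕜 := ℝ) (Θ 0) (Θ 26)
  have hq1 := horb.abs_sub_le hG hσ hconv hm1 hm2
  have hd : |n * (2 * Real.pi) - (n * (2 * Real.pi) + 2 * Real.pi)| = 2 * Real.pi := by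
    rw [sub_add_cancel_left, abs_neg, abs_of_pos Real.two_pi_pos]
  have hr1 := horb.le_mul hG hσ hconv hm1 hm2 (by rw [hd]; linarith)
  have hr2 := horb.le_mul hG hσ hconv hm2 hm1 (by rw [abs_sub_comm, hd]; linarith)
  rw [hd] at hq1
  have hp1 := horb.pos _ hm1
  have hp2 := horb.pos _ hm2
  rcases hdisp n hm1 hm2 with ⟨-, he⟩ | ⟨-, he⟩
  · refine ⟨_, hp1, hle _ hm1, ?_⟩
    rw [he, abs_sub_comm]
    refine hq1.trans ?_
    set x := ρ (n * (2 * Real.pi))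
    set y := ρ (n * (2 * Real.pi) + 2 * Real.pi)
    calc x * (2 * Real.pi) * (2 * C * y) ≤ x * (2 * Real.pi) * (2 * C * (3 / 2 * x)) := by gcongr
      _ = _ := by ring
  · refine ⟨_, hp2, hle _ hm2, ?_⟩
    rw [he]
    refine hq1.trans ?_
    set x := ρ (n * (2 * Real.pi))
    set y := ρ (n * (2 * Real.pi) + 2 * Real.pi)
    calc x * (2 * Real.pi) * (2 * C * y) ≤ (3 / 2 * y) * (2 * Real.pi) * (2 * C * y) := by gcongr
      _ = _ := by ring

/-- In the inward time direction an orbit that starts near the origin is a power spiral. -/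
theorem IsComplexOrbit.exists_isPowerSpiral {G : ℂ → ℂ} {C δ σ : ℝ}
    (hG : IsSmallPerturbation G C δ) (hσ : σ = 1 ∨ σ = -1) {f : ℝ → ℝ} (hf : IsDisplacement G δ f)
    {c c' : ℝ} {m : ℕ} (hc : 0 < c) (hc' : 0 ≤ c')
    (hfb : ∀ r, 0 < r → r < δ → c * r ^ m ≤ -σ * f r ∧ -σ * f r ≤ c' * r ^ m)
    {ζ : ℝ → ℂ} (h : IsComplexOrbit G σ ζ (Ici 0)) (h0 : ‖ζ 0‖ < δ / 4) :
    ∃ (ρ : ℝ → ℝ) (c₁ C₁ t₁ : ℝ), 0 < c₁ ∧ 0 ≤ C₁ ∧ 0 ≤ t₁ ∧ IsPowerSpiral ρ m c₁ C₁ ∧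
      (∀ θ, 0 ≤ θ → ∃ t, 0 ≤ t ∧ ζ t = polarPoint σ θ (ρ θ)) ∧
      ∀ t, t₁ ≤ t → ∃ θ, 0 ≤ θ ∧ ζ t = polarPoint σ θ (ρ θ) := by
  have hpi := Real.pi_pos
  have hstay : ∀ t ∈ Ici (0 : ℝ), ‖ζ t‖ < δ := fun t ht => by
    have := (h.mono (J := Icc 0 t) fun s hs => hs.1).norm_le_three_mul hG hσ hf
      (fun r hr hrδ => le_trans (by positivity) (hfb r hr hrδ).1) h0 t ⟨ht, le_rfl⟩
    linarith [hG.pos]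
  obtain ⟨Θ, τ, ρ, hΘc, hb, hτ1, hτ2, hpol, horb, hconv, hdisp⟩ := h.exists_polar hG hσ hstay
    (p := fun t => max 0 t) (by fun_prop) (fun t => mem_Ici.2 (le_max_left _ _))
    (fun t ht => max_eq_right ht) (fun t ht => ht)
    (fun t _ s hs => ⟨hs.1, mem_of_superset self_mem_nhdsWithin (Ici_subset_Ici.2 hs.1)⟩)
    ordConnected_Ici
  have hΘm : ∀ s t, s ≤ t → Θ s ≤ Θ t := fun s t hst => by linarith [(hb s t hst).1]
  have himg : Θ '' Ici 0 = Ici (Θ 0) := by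
    ext θ
    constructor
    · rintro ⟨t, ht, rfl⟩
      exact hΘm 0 t ht
    · intro hθ
      refine ⟨τ θ, ?_, hτ2 θ⟩
      by_contra hneg
      have hneg : τ θ < 0 := not_le.1 hneg
      have h1 := (hb (τ θ) 0 hneg.le).1
      rw [hτ2] at h1
      have h2 : Θ 0 ≤ θ := hθ
      linarith
  rw [himg] at horb hconv
  obtain ⟨n₀, hn1, -⟩ := exists_int_mul_two_pi_mem (Θ 0)
  have hspiral := horb.isPowerSpiral hG hσ (m := m) (c := c * (2 / 3) ^ m) (c' := c' * (3 / 2) ^ m)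
    (by positivity) (fun n hn => by
      have hm1 : n * (2 * Real.pi) ∈ Ici (Θ 0) := hn
      have hm2 : n * (2 * Real.pi) + 2 * Real.pi ∈ Ici (Θ 0) := by
        rw [mem_Ici]; linarith
      have hd : |n * (2 * Real.pi) - (n * (2 * Real.pi) + 2 * Real.pi)| = 2 * Real.pi := by
        rw [sub_add_cancel_left, abs_neg, abs_of_pos Real.two_pi_pos]
      exact gap_bounds_of_displacement hc hc' hfb (horb.pos _ hm1) (horb.lt _ hm1)
        (horb.pos _ hm2) (horb.lt _ hm2)
        (horb.le_mul hG hσ hconv hm1 hm2 (by rw [hd]; linarith))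
        (horb.le_mul hG hσ hconv hm2 hm1 (by rw [abs_sub_comm, hd]; linarith))
        (hdisp f hf n (himg ▸ hm1) (himg ▸ hm2))) n₀ hn1
  have hshift : ∀ (θ x : ℝ), polarPoint σ (θ + n₀ * (2 * Real.pi)) x = polarPoint σ θ x := by
    intro θ x
    have e : ((σ * (θ + n₀ * (2 * Real.pi)) : ℝ) : ℂ) = (σ * θ : ℝ) + (σ * (n₀ * (2 * Real.pi)) : ℝ) := by
      push_cast; ring
    have h1 := polarPoint_int_mul_two_pi hσ n₀ 1
    rw [polarPoint, Complex.ofReal_one, one_mul] at h1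
    rw [polarPoint, polarPoint, e, mul_add, Complex.exp_add, h1, mul_one]
  -- The spiral is parametrised from the section angle of index `n₀`; `t₁` is the time at which that
  -- angle is reached.
  refine ⟨_, _, _, max 0 (τ (n₀ * (2 * Real.pi))), by positivity, by positivity, le_max_left _ _,
    hspiral, fun θ hθ => ?_, fun t ht => ?_⟩
  · have hmem : θ + n₀ * (2 * Real.pi) ∈ Θ '' Ici 0 := by
      rw [himg, mem_Ici]; linarith
    obtain ⟨t, ht, he⟩ := hmem
    refine ⟨t, ht, ?_⟩
    rw [(hpol t ht).1, he, hshift]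
  · have ht0 : 0 ≤ t := (le_max_left _ _).trans ht
    refine ⟨Θ t - n₀ * (2 * Real.pi), ?_, ?_⟩
    · have := hΘm _ _ ((le_max_right _ _).trans ht)
      rw [hτ2] at this
      linarith
    · rw [sub_add_cancel, ← hshift, sub_add_cancel]
      exact (hpol t ht0).1

/-- An orbit that comes arbitrarily close to the origin follows the inward time direction. -/
theorem IsComplexOrbit.not_outward {G : ℂ → ℂ} {C δ σ : ℝ}
    (hG : IsSmallPerturbation G C δ) (hσ : σ = 1 ∨ σ = -1) {f : ℝ → ℝ} (hf : IsDisplacement G δ f)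
    (hfs : ∀ r, 0 < r → r < δ → 0 ≤ σ * f r)
    {ζ : ℝ → ℂ} (h : IsComplexOrbit G σ ζ (Ici 0)) :
    ∃ ε > 0, ∀ t, 0 ≤ t → ε ≤ ‖ζ t‖ := by
  have hz0 := norm_pos_iff.2 (h.ne_zero 0 self_mem_Ici)
  refine ⟨min (δ / 4) (‖ζ 0‖ / 4), lt_min (by linarith [hG.pos]) (by linarith), fun t ht => ?_⟩
  by_contra! hlt
  have h1 : ‖ζ t‖ < δ / 4 := hlt.trans_le (min_le_left _ _)
  have h2 : ‖ζ t‖ < ‖ζ 0‖ / 4 := hlt.trans_le (min_le_right _ _)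
  -- Reversed from time `t`, the orbit moves in the inward direction, so stability gives `‖ζ 0‖ ≤
  -- 3‖ζ t‖ < ‖ζ 0‖`.
  have hmaps : MapsTo (fun s => t + -1 * s) (Icc 0 t) (Ici 0) := fun s hs => by
    rw [mem_Ici]; linarith [hs.2]
  have h3 := h.comp_affine hmaps
  rw [neg_one_mul] at h3
  have h4 := h3.norm_le_three_mul hG (by rcases hσ with rfl | rfl <;> simp) hf
    (fun r hr hrδ => by rw [neg_neg]; exact hfs r hr hrδ) (by simpa using h1) t ⟨ht, le_rfl⟩
  simp only [mul_zero, add_zero, neg_one_mul, add_neg_cancel] at h4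
  linarith

/-! ### Analytic perturbations of order two -/

/-- The isometry between the complex numbers and the plane. -/
noncomputable abbrev complexPlane : ℂ ≃ₗᵢ[ℝ] Plane := Complex.orthonormalBasisOneI.repr

/-- The perturbation `(p + i q) / z` in complex notation. -/
noncomputable def complexPerturbation (p q : Plane → ℝ) (z : ℂ) : ℂ :=
  ((p (complexPlane z) : ℂ) + q (complexPlane z) * Complex.I) / z

theorem complexPlane_symm_weakFocusField (p q : Plane → ℝ) {w : Plane} (hw : w ≠ 0) :
    complexPlane.symm (weakFocusField p q w) =
      complexPlane.symm w * (Complex.I + complexPerturbation p q (complexPlane.symm w)) := by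
  have hz : complexPlane.symm w ≠ 0 := (map_ne_zero_iff _ complexPlane.symm.injective).2 hw
  rw [complexPerturbation, mul_add, mul_div_cancel₀ _ hz, LinearIsometryEquiv.apply_symm_apply]
  simp only [Complex.orthonormalBasisOneI_repr_symm_apply, weakFocusField]
  simp only [Matrix.cons_val_zero, Matrix.cons_val_one, Fin.isValue, Matrix.cons_val_fin_one]
  push_cast
  linear_combination (-(w 1 : ℂ)) * Complex.I_sq

/-- The gradient vanishes at `0` and is differentiable there, hence is `O(|x|)`; the mean value
inequality is applied on the closed ball of radius `‖a‖`, which also contains `b`. -/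
theorem IsAnalyticOrderTwo.exists_bounds {p : Plane → ℝ} {U : Set Plane} (hU : IsOpen U)
    (h0U : (0 : Plane) ∈ U) (hp : IsAnalyticOrderTwo p U) :
    ∃ K δ : ℝ, 0 ≤ K ∧ 0 < δ ∧ Metric.ball 0 δ ⊆ U ∧
      ∀ a b : Plane, ‖b‖ ≤ ‖a‖ → ‖a‖ < δ → |p a - p b| ≤ K * ‖a‖ * ‖a - b‖ := by
  obtain ⟨han, hp0, hd0⟩ := hp
  have hdiff : DifferentiableAt ℝ (fderiv ℝ p) 0 := (han 0 h0U).fderiv.differentiableAt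
  obtain ⟨K, hK, hb⟩ := hdiff.hasFDerivAt.isBigO_sub.exists_nonneg
  obtain ⟨δ₁, hδ₁, h1⟩ := Metric.eventually_nhds_iff_ball.1 hb.bound
  obtain ⟨δ₂, hδ₂, h2⟩ := Metric.isOpen_iff.1 hU 0 h0U
  refine ⟨K, min δ₁ δ₂, hK, lt_min hδ₁ hδ₂,
    (Metric.ball_subset_ball (min_le_right _ _)).trans h2, fun a b hba ha => ?_⟩
  have hin : ∀ x ∈ Metric.closedBall (0 : Plane) ‖a‖, ‖x‖ ≤ ‖a‖ := fun x hx => by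
    simpa using hx
  have hmv := (convex_closedBall (0 : Plane) ‖a‖).norm_image_sub_le_of_norm_hasFDerivWithin_le
    (f := p) (f' := fderiv ℝ p) (C := K * ‖a‖)
    (fun x hx => ((han x (h2 (by
      rw [mem_ball_zero_iff]
      exact (hin x hx).trans_lt (ha.trans_le (min_le_right _ _))))).differentiableAt.hasFDerivAt).hasFDerivWithinAt)
    (fun x hx => by
      have h3 := h1 x (by
        rw [mem_ball_zero_iff]
        exact (hin x hx).trans_lt (ha.trans_le (min_le_left _ _)))
      rw [hd0, sub_zero, sub_zero] at h3
      exact h3.trans (mul_le_mul_of_nonneg_left (hin x hx) hK))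
    (x := b) (y := a) (by simpa using hba) (by simp)
  rwa [Real.norm_eq_abs] at hmv

/-- With `h = p + iq`, one writes `h(a)/a - h(b)/b = (h(a) - h(b))/a - h(b)(a - b)/(ab)`. If `a` is
the point of larger modulus, each term is at most `K|a - b|`. -/
theorem exists_isSmallPerturbation {p q : Plane → ℝ} {U : Set Plane} (hU : IsOpen U)
    (h0U : (0 : Plane) ∈ U) (hp : IsAnalyticOrderTwo p U) (hq : IsAnalyticOrderTwo q U) :
    ∃ C δ : ℝ, IsSmallPerturbation (complexPerturbation p q) C δ ∧ Metric.ball 0 δ ⊆ U := by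
  obtain ⟨K₁, δ₁, hK₁, hδ₁, hb₁, h₁⟩ := hp.exists_bounds hU h0U
  obtain ⟨K₂, δ₂, hK₂, hδ₂, hb₂, h₂⟩ := hq.exists_bounds hU h0U
  set K := K₁ + K₂ with hK
  have hKn : 0 ≤ K := add_nonneg hK₁ hK₂
  set h : ℂ → ℂ := fun z => (p (complexPlane z) : ℂ) + q (complexPlane z) * Complex.I with hh
  have hh0 : h 0 = 0 := by simp [hh, hp.2.1, hq.2.1]
  set δ := min (min δ₁ δ₂) (1 / (100 * (2 * K + 1))) with hδ
  have hlip : ∀ a b : ℂ, ‖b‖ ≤ ‖a‖ → ‖a‖ < δ → ‖h a - h b‖ ≤ K * ‖a‖ * ‖a - b‖ := by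
    intro a b hba ha
    have ha₁ : ‖a‖ < δ₁ := ha.trans_le ((min_le_left _ _).trans (min_le_left _ _))
    have ha₂ : ‖a‖ < δ₂ := ha.trans_le ((min_le_left _ _).trans (min_le_right _ _))
    have e1 := h₁ (complexPlane a) (complexPlane b) (by simpa using hba) (by simpa using ha₁)
    have e2 := h₂ (complexPlane a) (complexPlane b) (by simpa using hba) (by simpa using ha₂)
    rw [← map_sub, LinearIsometryEquiv.norm_map, LinearIsometryEquiv.norm_map] at e1 e2
    have e3 : h a - h b = ((p (complexPlane a) - p (complexPlane b) : ℝ) : ℂ) +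
        ((q (complexPlane a) - q (complexPlane b) : ℝ) : ℂ) * Complex.I := by
      simp only [hh]; push_cast; ring
    rw [e3]
    refine (norm_add_le _ _).trans ?_
    rw [norm_mul, Complex.norm_I, mul_one, Complex.norm_real, Complex.norm_real, Real.norm_eq_abs,
      Real.norm_eq_abs, hK]
    linarith
  have hsmall : ∀ a : ℂ, ‖a‖ < δ → ‖h a‖ ≤ K * ‖a‖ * ‖a‖ := fun a ha => by
    have := hlip a 0 (by simp) ha
    rwa [hh0, sub_zero, sub_zero] at this
  have hGlip : ∀ a b : ℂ, a ≠ 0 → b ≠ 0 → ‖b‖ ≤ ‖a‖ → ‖a‖ < δ →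
      ‖complexPerturbation p q a - complexPerturbation p q b‖ ≤ 2 * K * ‖a - b‖ := by
    intro a b ha0 hb0 hba ha
    have hna := norm_pos_iff.2 ha0
    have hnb := norm_pos_iff.2 hb0
    have e : complexPerturbation p q a - complexPerturbation p q b =
        (h a - h b) / a - h b * (a - b) / (a * b) := by
      change h a / a - h b / b = _
      field_simp
      ring
    rw [e]
    refine (norm_sub_le _ _).trans ?_
    rw [norm_div, norm_div, norm_mul, norm_mul]
    have f1 : ‖h a - h b‖ / ‖a‖ ≤ K * ‖a - b‖ := by
      rw [div_le_iff₀ hna]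
      linarith [hlip a b hba ha]
    have f2 : ‖h b‖ * ‖a - b‖ / (‖a‖ * ‖b‖) ≤ K * ‖a - b‖ := by
      rw [div_le_iff₀ (mul_pos hna hnb)]
      calc ‖h b‖ * ‖a - b‖ ≤ (K * ‖b‖ * ‖b‖) * ‖a - b‖ := by
            gcongr; exact hsmall b (hba.trans_lt ha)
        _ ≤ (K * ‖a‖ * ‖b‖) * ‖a - b‖ := by gcongr
        _ = _ := by ring
    linarith
  have hδpos : 0 < δ := lt_min (lt_min hδ₁ hδ₂) (by positivity)
  refine ⟨2 * K, δ, ⟨by positivity, hδpos, ?_, ?_, ?_⟩, ?_⟩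
  · calc 2 * K * δ ≤ (2 * K + 1) * (1 / (100 * (2 * K + 1))) := by
          gcongr
          · linarith
          · exact min_le_right _ _
      _ = 1 / 100 := by field_simp
  · intro z hz hzδ
    have hn := norm_pos_iff.2 hz
    change ‖h z / z‖ ≤ _
    rw [norm_div, div_le_iff₀ hn]
    refine (hsmall z hzδ).trans ?_
    gcongr
    linarith
  · intro z w hz hw hzδ hwδ
    rcases le_total ‖w‖ ‖z‖ with hle | hle
    · exact hGlip z w hz hw hle hzδ
    · rw [norm_sub_rev, norm_sub_rev z]
      exact hGlip w z hw hz hle hwδ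
  · exact (Metric.ball_subset_ball ((min_le_left _ _).trans (min_le_left _ _))).trans hb₁

/-! ### Uniqueness of the first return -/

/-- Both arcs are compact subsets of `D`, and on their union local Lipschitz bounds become a uniform
one. -/
theorem IsSolutionOn.eqOn {X : Plane → Plane} {D : Set Plane} (hX : ∀ w ∈ D, ContDiffAt ℝ 1 X w)
    {γ γ' : ℝ → Plane} {T : ℝ} (h : IsSolutionOn X D γ (Icc 0 T))
    (h' : IsSolutionOn X D γ' (Icc 0 T)) (h0 : γ 0 = γ' 0) : EqOn γ γ' (Icc 0 T) := by
  have hc := h.2.continuousOn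
  have hc' := h'.2.continuousOn
  have hK : IsCompact (γ '' Icc 0 T ∪ γ' '' Icc 0 T) :=
    (isCompact_Icc.image_of_continuousOn hc).union (isCompact_Icc.image_of_continuousOn hc')
  have hKD : γ '' Icc 0 T ∪ γ' '' Icc 0 T ⊆ D :=
    union_subset (image_subset_iff.2 h.1) (image_subset_iff.2 h'.1)
  have hloc : LocallyLipschitzOn (γ '' Icc 0 T ∪ γ' '' Icc 0 T) X := fun w hw => by
    obtain ⟨L, t, ht, hL⟩ := (hX w (hKD hw)).exists_lipschitzOnWith
    exact ⟨L, t, mem_nhdsWithin_of_mem_nhds ht, hL⟩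
  obtain ⟨L, hL⟩ := hloc.exists_lipschitzOnWith_of_compact hK
  have hright : ∀ t ∈ Ico 0 T, Icc 0 T ∈ 𝓝[≥] t := fun t ht =>
    mem_of_superset (Icc_mem_nhdsGE ht.2) (Icc_subset_Icc_left ht.1)
  exact ODE_solution_unique_of_mem_Icc_right (v := fun _ => X) (K := L)
    (s := fun _ => γ '' Icc 0 T ∪ γ' '' Icc 0 T) (fun t _ => hL) hc
    (fun t ht => (h.2 t (Ico_subset_Icc_self ht)).mono_of_mem_nhdsWithin (hright t ht))
    (fun t ht => Or.inl ⟨t, Ico_subset_Icc_self ht, rfl⟩) hc'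
    (fun t ht => (h'.2 t (Ico_subset_Icc_self ht)).mono_of_mem_nhdsWithin (hright t ht))
    (fun t ht => Or.inr ⟨t, Ico_subset_Icc_self ht, rfl⟩) h0

theorem IsSolutionOn.mono {X : Plane → Plane} {D : Set Plane} {γ : ℝ → Plane} {I J : Set ℝ}
    (h : IsSolutionOn X D γ I) (hJ : J ⊆ I) : IsSolutionOn X D γ J :=
  ⟨h.1.mono_left hJ, h.2.mono hJ⟩

/-- If the return times differed, the slower solution would already be on the positive axis at the
earlier time. The choice made in `poincareMap` is thus immaterial. -/
theorem IsFirstReturn.unique {X : Plane → Plane} {D : Set Plane}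
    (hX : ∀ w ∈ D, ContDiffAt ℝ 1 X w) {r s s' : ℝ} (h : IsFirstReturn X D r s)
    (h' : IsFirstReturn X D r s') : s = s' := by
  obtain ⟨γ, T, hT, hsol, h0, hTs, hs, hno⟩ := h
  obtain ⟨γ', T', hT', hsol', h0', hTs', hs', hno'⟩ := h'
  rcases lt_trichotomy T T' with hlt | rfl | hlt
  · have := hsol.eqOn hX (hsol'.mono (Icc_subset_Icc_right hlt.le)) (h0.trans h0'.symm)
      (right_mem_Icc.2 hT.le)
    exact absurd (by rw [← this, hTs]; simpa using hs) (hno' T ⟨hT, hlt⟩)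
  · have := hsol.eqOn hX hsol' (h0.trans h0'.symm) (right_mem_Icc.2 hT.le)
    rw [hTs, hTs'] at this
    simpa using congrArg (fun w : Plane => w 0) this
  · have := hsol'.eqOn hX (hsol.mono (Icc_subset_Icc_right hlt.le)) (h0'.trans h0.symm)
      (right_mem_Icc.2 hT'.le)
    exact absurd (by rw [← this, hTs']; simpa using hs') (hno T' ⟨hT', hlt⟩)

theorem IsFirstReturn.displacement_eq {X : Plane → Plane} {D : Set Plane}
    (hX : ∀ w ∈ D, ContDiffAt ℝ 1 X w) {r s : ℝ} (h : IsFirstReturn X D r s) :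
    displacement X D r = s - r := by
  have hex : ∃ s, IsFirstReturn X D r s := ⟨s, h⟩
  rw [displacement, poincareMap, dif_pos hex, hex.choose_spec.unique hX h]

/-! ### Geometric inversion of vector fields -/

theorem geomInversion_geomInversion {n : ℕ} (x : EuclideanSpace ℝ (Fin n)) :
    geomInversion (geomInversion x) = x :=
  EuclideanGeometry.inversion_inversion 0 one_ne_zero x

theorem geomInversion_ne_zero {n : ℕ} {x : EuclideanSpace ℝ (Fin n)} (hx : x ≠ 0) :
    geomInversion x ≠ 0 := by
  rw [geomInversion_apply]
  exact smul_ne_zero (inv_ne_zero (pow_ne_zero 2 (norm_ne_zero_iff.2 hx))) hx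

theorem norm_geomInversion {n : ℕ} (x : EuclideanSpace ℝ (Fin n)) :
    ‖geomInversion x‖ = ‖x‖⁻¹ := by
  rcases eq_or_ne x 0 with rfl | hx
  · simp [geomInversion_apply]
  · have := norm_ne_zero_iff.2 hx
    rw [geomInversion_apply, norm_smul, norm_inv, norm_pow, norm_norm]
    field_simp

/-- Inversion is an involution, hence so is the induced change of variables on fields. The Lyapunov
coefficients at infinity thereby refer to the original weak focus. -/
theorem invertField_invertField {n : ℕ} (X : EuclideanSpace ℝ (Fin n) → EuclideanSpace ℝ (Fin n))
    {x : EuclideanSpace ℝ (Fin n)} (hx : x ≠ 0) : invertField (invertField X) x = X x := by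
  have hn := norm_ne_zero_iff.2 hx
  simp only [invertField, geomInversion_geomInversion x, norm_geomInversion]
  rw [geomInversion_apply]
  set v := X x
  simp only [inner_sub_right, inner_smul_left, inner_smul_right, real_inner_self_eq_norm_sq,
    conj_trivial, smul_sub, smul_smul]
  have e1 : ‖x‖ ^ 2 * ‖x‖⁻¹ ^ 2 = 1 := by field_simp
  rw [e1, one_smul, sub_sub, ← add_smul]
  have e2 : (‖x‖ ^ 2 * (2 * ((‖x‖ ^ 2)⁻¹ * inner ℝ x v) * (‖x‖ ^ 2)⁻¹) +
      2 * (‖x‖⁻¹ ^ 2 * inner ℝ x v - 2 * ((‖x‖ ^ 2)⁻¹ * inner ℝ x v) * (‖x‖ ^ 2)⁻¹ * ‖x‖ ^ 2)) = 0 := by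
    field_simp
    ring
  rw [e2, zero_smul, sub_zero]

theorem hasDerivWithinAt_geomInversion {n : ℕ}
    {X : EuclideanSpace ℝ (Fin n) → EuclideanSpace ℝ (Fin n)} {γ : ℝ → EuclideanSpace ℝ (Fin n)}
    {I : Set ℝ} {t : ℝ} (h : HasDerivWithinAt γ (invertField X (γ t)) I t) (h0 : γ t ≠ 0) :
    HasDerivWithinAt (fun s => geomInversion (γ s)) (X (geomInversion (γ t))) I t := by
  have hn := norm_ne_zero_iff.2 h0
  simp only [geomInversion_apply]
  have h1 := (h.norm_sq.fun_inv (pow_ne_zero 2 hn)).smul h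
  refine h1.congr_deriv ?_
  rw [← geomInversion_apply]
  simp only [invertField]
  set v := X (geomInversion (γ t))
  simp only [inner_sub_right, inner_smul_right, real_inner_self_eq_norm_sq, smul_sub, smul_smul]
  have e1 : (‖γ t‖ ^ 2)⁻¹ * ‖γ t‖ ^ 2 = 1 := by field_simp
  rw [e1, one_smul, sub_add, ← sub_smul]
  have e2 : (‖γ t‖ ^ 2)⁻¹ * (2 * inner ℝ (γ t) v) -
      -(2 * (‖γ t‖ ^ 2 * inner ℝ (γ t) v - 2 * inner ℝ (γ t) v * ‖γ t‖ ^ 2)) / (‖γ t‖ ^ 2) ^ 2 = 0 := by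
    field_simp
    ring
  rw [e2, zero_smul, sub_zero]

/-! ### Weak foci and their inversions -/

theorem mem_invertDomain_invertDomain {n : ℕ} {D : Set (EuclideanSpace ℝ (Fin n))}
    {x : EuclideanSpace ℝ (Fin n)} : x ∈ invertDomain (invertDomain D) ↔ x ≠ 0 ∧ x ∈ D := by
  refine ⟨fun h => ⟨h.1, ?_⟩, fun h => ⟨h.1, geomInversion_ne_zero h.1, ?_⟩⟩
  · have := h.2.2
    rwa [geomInversion_geomInversion] at this
  · rw [geomInversion_geomInversion]; exact h.2

theorem invertField_invertedWeakFocusField (p q : Plane → ℝ) {w : Plane} (hw : w ≠ 0) :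
    invertField (invertedWeakFocusField p q) w = weakFocusField p q w := by
  rw [← invertField_invertField (weakFocusField p q) hw]
  have hcongr : ∀ Y Z : Plane → Plane, Y (geomInversion w) = Z (geomInversion w) →
      invertField Y w = invertField Z w := fun Y Z h => by simp only [invertField, h]
  exact hcongr _ _ (invertField_weakFocusField p q (geomInversion_ne_zero hw)).symm

theorem contDiffAt_weakFocusField {p q : Plane → ℝ} {w : Plane} (hp : AnalyticAt ℝ p w)
    (hq : AnalyticAt ℝ q w) : ContDiffAt ℝ 1 (weakFocusField p q) w := by
  have hc : ∀ i, ContDiffAt ℝ 1 (fun z : Plane => z i) w := fun i =>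
    contDiffAt_euclidean.1 contDiffAt_id i
  rw [contDiffAt_euclidean]
  intro i
  fin_cases i
  · simpa [weakFocusField] using (hc 1).neg.add hp.contDiffAt
  · simpa [weakFocusField] using (hc 0).add hq.contDiffAt

theorem contDiffAt_invertField_invertedWeakFocusField {p q : Plane → ℝ} {w : Plane}
    (hp : AnalyticAt ℝ p w) (hq : AnalyticAt ℝ q w) (hw : w ≠ 0) :
    ContDiffAt ℝ 1 (invertField (invertedWeakFocusField p q)) w := by
  refine (contDiffAt_weakFocusField hp hq).congr_of_eventuallyEq ?_
  filter_upwards [isOpen_ne.mem_nhds hw] with x hx using invertField_invertedWeakFocusField p q hx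

/-- Off the origin the doubly inverted field is the weak focus field, so a first return of the
complex equation inside the disc is one of the system that defines the Lyapunov coefficients. -/
theorem isDisplacement_weakFocus {p q : Plane → ℝ} {U : Set Plane}
    (hp : IsAnalyticOrderTwo p U) (hq : IsAnalyticOrderTwo q U) {δ : ℝ}
    (hδ : Metric.ball 0 δ ⊆ U) :
    IsDisplacement (complexPerturbation p q) δ
      (displacement (invertField (invertedWeakFocusField p q)) (invertDomain (invertDomain U))) := by
  intro γ T r s hT hγ hγδ hr hs h0 hTs hno
  have hne : ∀ t ∈ Icc 0 T, complexPlane (γ t) ≠ 0 := fun t ht =>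
    (map_ne_zero_iff _ complexPlane.injective).2 (hγ.ne_zero t ht)
  have hpt : ∀ x : ℝ, complexPlane x = !₂[x, 0] := fun x => by
    ext i; fin_cases i <;> simp [Complex.orthonormalBasisOneI_repr_apply]
  refine IsFirstReturn.displacement_eq (fun w hw => ?_)
    ⟨fun t => complexPlane (γ t), T, hT, ⟨fun t ht => ?_, fun t ht => ?_⟩, ?_, ?_, hs, ?_⟩
  · obtain ⟨hw0, hwU⟩ := mem_invertDomain_invertDomain.1 hw
    exact contDiffAt_invertField_invertedWeakFocusField (hp.1 w hwU) (hq.1 w hwU) hw0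
  · refine mem_invertDomain_invertDomain.2 ⟨hne t ht, hδ ?_⟩
    rw [mem_ball_zero_iff, LinearIsometryEquiv.norm_map]
    exact hγδ t ht
  · have h1 := complexPlane.toContinuousLinearEquiv.toContinuousLinearMap.hasFDerivAt
      (x := γ t) |>.comp_hasDerivWithinAt t (hγ.deriv t ht)
    refine h1.congr_deriv ?_
    change complexPlane ((1 : ℝ) * (γ t * (Complex.I + complexPerturbation p q (γ t)))) =
      invertField (invertedWeakFocusField p q) (complexPlane (γ t))
    rw [invertField_invertedWeakFocusField p q (hne t ht),
      ← LinearIsometryEquiv.apply_symm_apply complexPlane (weakFocusField p q (complexPlane (γ t))),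
      complexPlane_symm_weakFocusField p q (hne t ht), LinearIsometryEquiv.symm_apply_apply,
      Complex.ofReal_one, one_mul]
  · simp only [h0, hpt]
  · simp only [hTs, hpt]
  · intro t ht
    exact hno t ht

/-- The inverse of a trajectory at infinity is an orbit of the weak focus, traversed in one of the
two time directions. -/
theorem IsSemitrajectory.exists_inverted {p q : Plane → ℝ} {U Γ : Set Plane}
    (h : IsSemitrajectory (invertedWeakFocusField p q) (invertDomain U) Γ) :
    ∃ (σ : ℝ) (z : ℝ → Plane), (σ = 1 ∨ σ = -1) ∧ geomInversion '' Γ = z '' Ici 0 ∧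
      ∀ t ∈ Ici (0 : ℝ), z t ∈ U ∧ z t ≠ 0 ∧
        HasDerivWithinAt z (σ • weakFocusField p q (z t)) (Ici 0) t := by
  obtain ⟨γ, t₀, I, hI, ⟨hmaps, hint⟩, rfl⟩ := h
  obtain ⟨σ, hσ, hσI⟩ : ∃ σ : ℝ, (σ = 1 ∨ σ = -1) ∧ (fun t => t₀ + σ * t) '' Ici 0 = I := by
    rcases hI with rfl | rfl
    · refine ⟨1, Or.inl rfl, ?_⟩
      ext t
      simp only [mem_image, mem_Ici, one_mul]
      exact ⟨fun ⟨s, hs, he⟩ => by linarith, fun ht => ⟨t - t₀, by linarith, by ring⟩⟩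
    · refine ⟨-1, Or.inr rfl, ?_⟩
      ext t
      simp only [mem_image, mem_Ici, mem_Iic]
      exact ⟨fun ⟨s, hs, he⟩ => by linarith, fun ht => ⟨t₀ - t, by linarith, by ring⟩⟩
  have hmI : MapsTo (fun t => t₀ + σ * t) (Ici 0) I := by
    rw [← hσI]; exact mapsTo_image _ _
  refine ⟨σ, fun t => geomInversion (γ (t₀ + σ * t)), hσ, ?_, fun t ht => ?_⟩
  · rw [← hσI, image_image, image_image]
  · obtain ⟨hne, hmem⟩ := hmaps (hmI ht)
    refine ⟨hmem, geomInversion_ne_zero hne, ?_⟩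
    have h1 := hint _ (hmI ht)
    change HasDerivWithinAt γ (invertedWeakFocusField p q (γ (t₀ + σ * t))) I _ at h1
    rw [← invertField_weakFocusField p q hne] at h1
    have h2 := hasDerivWithinAt_geomInversion h1 hne
    have h3 : HasDerivWithinAt (fun t => t₀ + σ * t) σ (Ici 0) t := by
      simpa using (((hasDerivAt_id t).const_mul σ).const_add t₀).hasDerivWithinAt
    exact h2.scomp t h3 hmI

theorem isComplexOrbit_of_weakFocus {p q : Plane → ℝ} {σ : ℝ} {z : ℝ → Plane} {I : Set ℝ}
    (hz : ∀ t ∈ I, z t ≠ 0 ∧ HasDerivWithinAt z (σ • weakFocusField p q (z t)) I t) :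
    IsComplexOrbit (complexPerturbation p q) σ (fun t => complexPlane.symm (z t)) I := by
  refine ⟨fun t ht => (map_ne_zero_iff _ complexPlane.symm.injective).2 (hz t ht).1, fun t ht => ?_⟩
  have h1 := complexPlane.symm.toContinuousLinearEquiv.toContinuousLinearMap.hasFDerivAt
      (x := z t) |>.comp_hasDerivWithinAt t (hz t ht).2
  refine h1.congr_deriv ?_
  rw [← complexPlane_symm_weakFocusField p q (hz t ht).1, map_smul, Complex.real_smul]
  rfl

theorem complexPlane_polarPoint {σ : ℝ} (hσ : σ = 1 ∨ σ = -1) (θ x : ℝ) :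
    complexPlane (polarPoint σ θ x) = spiralPoint σ x θ := by
  ext i
  fin_cases i
  · rcases hσ with rfl | rfl <;>
      simp [Complex.orthonormalBasisOneI_repr_apply, polarPoint_re, spiralPoint]
  · rcases hσ with rfl | rfl <;>
      simp [Complex.orthonormalBasisOneI_repr_apply, polarPoint_im, spiralPoint]

/-- A Lipschitz bound for a solution on a compact time interval. -/
theorem exists_lipschitz_of_weakFocus {p q : Plane → ℝ} {U : Set Plane}
    (hp : AnalyticOnNhd ℝ p U) (hq : AnalyticOnNhd ℝ q U) {σ b : ℝ} {z : ℝ → Plane}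
    (hz : ∀ t ∈ Icc 0 b, z t ∈ U ∧
      HasDerivWithinAt z (σ • weakFocusField p q (z t)) (Icc 0 b) t) :
    ∃ Λ : ℝ, 0 ≤ Λ ∧ ∀ s ∈ Icc 0 b, ∀ t ∈ Icc 0 b, dist (z s) (z t) ≤ Λ * |s - t| := by
  have hzc : ContinuousOn z (Icc 0 b) := fun t ht => (hz t ht).2.continuousWithinAt
  have hXc : ContinuousOn (weakFocusField p q) U := fun w hw =>
    (contDiffAt_weakFocusField (hp w hw) (hq w hw)).continuousAt.continuousWithinAt
  have hc : ContinuousOn (fun t => σ • weakFocusField p q (z t)) (Icc 0 b) :=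
    (hXc.comp hzc fun t ht => (hz t ht).1).const_smul σ
  obtain ⟨Λ, hΛ⟩ := isCompact_Icc.exists_bound_of_continuousOn hc
  refine ⟨max Λ 0, le_max_right _ _, fun s hs t ht => ?_⟩
  have := (convex_Icc 0 b).norm_image_sub_le_of_norm_hasDerivWithin_le (f := z) (C := max Λ 0)
    (fun t ht => (hz t ht).2) (fun t ht => (hΛ t ht).trans (le_max_left _ _)) ht hs
  rwa [dist_eq_norm]

/-! ### From the leading term of the displacement to the dimension. -/

/-- A function with a nonzero leading coefficient is bounded above and below by powers. -/
theorem exists_power_bounds {f : ℝ → ℝ} {m : ℕ} {a : ℝ} (ha : 0 < a)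
    (hf : Tendsto (fun r => f r / r ^ m) (𝓝[>] 0) (𝓝 a)) :
    ∃ δ > 0, ∀ r, 0 < r → r < δ → a / 2 * r ^ m ≤ f r ∧ f r ≤ 2 * a * r ^ m := by
  have h1 := (hf.eventually_const_lt (by linarith : a / 2 < a)).and
    (hf.eventually_lt_const (by linarith : a < 2 * a))
  obtain ⟨δ, hδ, h⟩ := mem_nhdsGT_iff_exists_Ioo_subset.1 h1
  refine ⟨δ, hδ, fun r hr hrδ => ?_⟩
  obtain ⟨h2, h3⟩ := h ⟨hr, hrδ⟩
  rw [lt_div_iff₀ (by positivity)] at h2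
  rw [div_lt_iff₀ (by positivity)] at h3
  exact ⟨h2.le, h3.le⟩

theorem IsSmallPerturbation.mono {G : ℂ → ℂ} {C δ δ' : ℝ} (h : IsSmallPerturbation G C δ)
    (hδ' : 0 < δ') (hle : δ' ≤ δ) : IsSmallPerturbation G C δ' :=
  ⟨h.nonneg, hδ', (mul_le_mul_of_nonneg_left hle h.nonneg).trans h.mul_le,
    fun z hz hzδ => h.norm_le z hz (hzδ.trans_le hle),
    fun z w hz hw hzδ hwδ => h.lip z w hz hw (hzδ.trans_le hle) (hwδ.trans_le hle)⟩

theorem IsDisplacement.mono {G : ℂ → ℂ} {δ δ' : ℝ} {f : ℝ → ℝ} (h : IsDisplacement G δ f)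
    (hle : δ' ≤ δ) : IsDisplacement G δ' f :=
  fun γ T r s hT hγ hγδ => h γ T r s hT hγ fun t ht => (hγδ t ht).trans_le hle

/-- Box dimension of a spiral orbit of `ζ' = ζ (i + G(ζ))` that accumulates at the origin. -/
theorem boxDim_of_displacement {p q : Plane → ℝ} {U : Set Plane}
    (hp : AnalyticOnNhd ℝ p U) (hq : AnalyticOnNhd ℝ q U) {C δ : ℝ}
    (hG : IsSmallPerturbation (complexPerturbation p q) C δ) {f : ℝ → ℝ}
    (hf : IsDisplacement (complexPerturbation p q) δ f) {m : ℕ} (hm : 3 ≤ m) {a : ℝ} (ha : a ≠ 0)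
    (hfa : Tendsto (fun r => f r / r ^ m) (𝓝[>] 0) (𝓝 a)) {σ : ℝ} (hσ : σ = 1 ∨ σ = -1)
    {z : ℝ → Plane} (hz : ∀ t ∈ Ici (0 : ℝ), z t ∈ U ∧ z t ≠ 0 ∧
      HasDerivWithinAt z (σ • weakFocusField p q (z t)) (Ici 0) t)
    (hlim : ∀ ε > 0, ∃ t, 0 ≤ t ∧ ‖z t‖ < ε) :
    upperBoxDim (z '' Ici 0) = 2 - 2 / m ∧ lowerBoxDim (z '' Ici 0) = 2 - 2 / m ∧
      MinkowskiNondegenerate (z '' Ici 0) := by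
  have horb := isComplexOrbit_of_weakFocus fun t ht => (hz t ht).2
  have hσ0 : σ ≠ 0 := by rcases hσ with rfl | rfl <;> norm_num
  have hσ2 : σ ^ 2 = 1 := by rcases hσ with rfl | rfl <;> norm_num
  -- Were the chosen time direction outward, `not_outward` would contradict `hlim`.
  have hin : 0 < -σ * a := by
    by_contra hneg
    have hpos : 0 < σ * a := lt_of_le_of_ne (by linarith) (mul_ne_zero hσ0 ha).symm
    have hlim' : Tendsto (fun r => (σ * f r) / r ^ m) (𝓝[>] 0) (𝓝 (σ * a)) := by
      simpa only [mul_div_assoc] using hfa.const_mul σ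
    obtain ⟨δ', hδ', hb⟩ := exists_power_bounds hpos hlim'
    have hmin : 0 < min δ δ' := lt_min hG.pos hδ'
    obtain ⟨ε, hε, hfar⟩ := horb.not_outward (hG.mono hmin (min_le_left _ _)) hσ
      (hf.mono (min_le_left _ _)) fun r hr hrδ =>
        le_trans (by positivity) (hb r hr (hrδ.trans_le (min_le_right _ _))).1
    obtain ⟨t, ht, htε⟩ := hlim ε hε
    have := hfar t ht
    rw [LinearIsometryEquiv.norm_map] at this
    linarith
  have hlim' : Tendsto (fun r => (-σ * f r) / r ^ m) (𝓝[>] 0) (𝓝 (-σ * a)) := by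
    simpa only [mul_div_assoc] using hfa.const_mul (-σ)
  obtain ⟨δ', hδ', hb⟩ := exists_power_bounds hin hlim'
  have hmin : 0 < min δ δ' := lt_min hG.pos hδ'
  obtain ⟨t₀, ht₀, hsmall⟩ := hlim (min δ δ' / 4) (by positivity)
  have hmaps : MapsTo (fun t => t₀ + 1 * t) (Ici 0) (Ici 0) := fun t ht => by
    rw [mem_Ici] at ht ⊢; linarith
  have horb' := horb.comp_affine hmaps
  rw [one_mul] at horb'
  obtain ⟨ρ, c, C', t₁, hc, hC', ht₁, hρ, hcurve, htail⟩ := horb'.exists_isPowerSpiral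
    (hG.mono hmin (min_le_left _ _)) hσ (hf.mono (min_le_left _ _)) (m := m)
    (c := -σ * a / 2) (c' := 2 * (-σ * a)) (by positivity) (by positivity)
    (fun r hr hrδ => hb r hr (hrδ.trans_le (min_le_right _ _)))
    (by simpa only [mul_zero, add_zero, LinearIsometryEquiv.norm_map] using hsmall)
  have hb0 : 0 ≤ t₀ + t₁ := add_nonneg ht₀ ht₁
  -- Before time `t₀ + t₁` the orbit may be far from the origin; only its Lipschitz bound matters
  -- there.
  obtain ⟨Λ, hΛ, hlip⟩ := exists_lipschitz_of_weakFocus hp hq (σ := σ) (b := t₀ + t₁) (z := z)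
    fun t ht => ⟨(hz t ht.1).1, (hz t ht.1).2.2.mono fun s hs => hs.1⟩
  have hmemS : ∀ θ, 0 ≤ θ → spiralPoint σ (ρ θ) θ ∈ z '' Ici 0 := fun θ hθ => by
    obtain ⟨t, ht, he⟩ := hcurve θ hθ
    refine ⟨t₀ + 1 * t, hmaps ht, ?_⟩
    rw [← complexPlane_polarPoint hσ, ← he, LinearIsometryEquiv.apply_symm_apply]
  have hS : ∀ w ∈ z '' Ici 0, w ∈ z '' Icc 0 (t₀ + t₁) ∨
      ∃ θ, 0 ≤ θ ∧ w = spiralPoint σ (ρ θ) θ := by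
    rintro _ ⟨t, ht, rfl⟩
    rcases le_total t (t₀ + t₁) with hle | hle
    · exact Or.inl ⟨t, ⟨ht, hle⟩, rfl⟩
    · obtain ⟨θ, hθ, he⟩ := htail (t - t₀) (by linarith)
      refine Or.inr ⟨θ, hθ, ?_⟩
      rw [← complexPlane_polarPoint hσ, ← he, LinearIsometryEquiv.apply_symm_apply]
      congr 1
      ring
  obtain ⟨c'', hc'', hlow⟩ := hρ.volume_thickening_ge hc hC' hm hσ2 hmemS
  obtain ⟨C'', hup⟩ := hρ.volume_thickening_le hc hm hσ2 hb0 hΛ hlip hS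
  have e : (2 : ℝ) / m = 2 - (2 - 2 / m) := by ring
  rw [e] at hlow hup
  have hm3 : (3 : ℝ) ≤ m := by exact_mod_cast hm
  have hd : (0 : ℝ) < 2 - 2 / m := by
    have : (2 : ℝ) / m < 2 := by
      rw [div_lt_iff₀ (by linarith)]; linarith
    linarith
  exact boxDim_of_volume_thickening_bounds hd hc'' hlow hup

/-- The given orbit exists for all times and comes arbitrarily close to `0`, so it provides genuine
returns at arbitrarily small radii without any existence theorem for neighbouring solutions. -/
theorem frequently_displacement_le {p q : Plane → ℝ} {C δ : ℝ}
    (hG : IsSmallPerturbation (complexPerturbation p q) C δ) {f : ℝ → ℝ}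
    (hf : IsDisplacement (complexPerturbation p q) δ f) {σ : ℝ} (hσ : σ = 1 ∨ σ = -1)
    {z : ℝ → Plane} (hz : ∀ t ∈ Ici (0 : ℝ), z t ≠ 0 ∧
      HasDerivWithinAt z (σ • weakFocusField p q (z t)) (Ici 0) t)
    (hlim : ∀ ε > 0, ∃ t, 0 ≤ t ∧ ‖z t‖ < ε) :
    ∃ᶠ r in 𝓝[>] (0 : ℝ), |f r| ≤ (6 * Real.pi * C) * r ^ 2 := by
  have horb := isComplexOrbit_of_weakFocus hz
  rw [(nhdsGT_basis (0 : ℝ)).frequently_iff]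
  intro ε hε
  obtain ⟨t₀, ht₀, hsmall⟩ := hlim (min (δ / 4) (ε / 4))
    (lt_min (by linarith [hG.pos]) (by linarith))
  have hmaps : MapsTo (fun t => t₀ + 1 * t) (Icc 0 26) (Ici 0) := fun t ht => by
    rw [mem_Ici]; linarith [ht.1]
  have horb' := horb.comp_affine hmaps
  rw [one_mul] at horb'
  obtain ⟨r, hr, hrle, hle⟩ := horb'.exists_displacement_le hG hσ hf (by
    simpa only [mul_zero, add_zero, LinearIsometryEquiv.norm_map] using
      hsmall.trans_le (min_le_left _ _))
  refine ⟨r, ⟨hr, ?_⟩, hle⟩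
  simp only [mul_zero, add_zero, LinearIsometryEquiv.norm_map] at hrle
  linarith [hsmall.trans_le (min_le_right _ _)]

theorem theorem3p3 (U : Set Plane) (hU : IsOpen U) (h0U : (0 : Plane) ∈ U)
    (p q : Plane → ℝ) (hp : IsAnalyticOrderTwo p U) (hq : IsAnalyticOrderTwo q U)
    (k : ℕ)
    (hV : lyapunovCoeffAtInfinity (invertedWeakFocusField p q) (invertDomain U) (2 * k + 1) ≠ 0)
    (hV_first : ∀ j < 2 * k + 1,
      lyapunovCoeffAtInfinity (invertedWeakFocusField p q) (invertDomain U) j = 0)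
    (Γ : Set Plane)
    (hΓ : IsSemitrajectory (invertedWeakFocusField p q) (invertDomain U) Γ)
    (hΓ_unbounded : ¬ Bornology.IsBounded Γ) (hΓ_away : AwayFromOrigin Γ) :
    HasUnboundedBoxDim Γ (2 * (1 - 1 / (2 * (k : ℝ) + 1))) ∧
      UnboundedMinkowskiNondegenerate Γ := by
  obtain ⟨C, δ, hG, hδU⟩ := exists_isSmallPerturbation hU h0U hp hq
  have hf := isDisplacement_weakFocus hp hq hδU
  obtain ⟨σ, z, hσ, himg, hz⟩ := hΓ.exists_inverted
  have hlim : ∀ ε > 0, ∃ t, 0 ≤ t ∧ ‖z t‖ < ε := by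
    intro ε hε
    by_contra! hcon
    refine hΓ_unbounded (isBounded_iff_forall_norm_le.2 ⟨ε⁻¹, fun w hw => ?_⟩)
    have : geomInversion w ∈ z '' Ici 0 := himg ▸ mem_image_of_mem _ hw
    obtain ⟨t, ht, he⟩ := this
    have h1 := hcon t ht
    rw [he, norm_geomInversion] at h1
    exact (le_inv_comm₀ hε (inv_pos.1 (hε.trans_le h1))).1 h1
  set f := displacement (invertField (invertedWeakFocusField p q)) (invertDomain (invertDomain U))
    with hfdef
  have hfreq := frequently_displacement_le hG hf hσ (fun t ht => (hz t ht).2) hlim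
  have hfa := tendsto_div_pow_of_iteratedDerivWithin (f := f) (n := 2 * k) (fun j hj => by
      have := hV_first j (by omega)
      rw [lyapunovCoeffAtInfinity, lyapunovCoeff] at this
      exact (div_eq_zero_iff.1 this).resolve_right (by positivity))
    (fun h0 => hV (by rw [lyapunovCoeffAtInfinity, lyapunovCoeff, ← hfdef, h0, zero_div])) hfreq
  change Tendsto _ _ (𝓝 (lyapunovCoeffAtInfinity (invertedWeakFocusField p q) (invertDomain U)
    (2 * k + 1))) at hfa
  -- If `k = 0`, then `f r / r` would have a nonzero limit, although `|f r|` is at most a multiple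
  -- of `r²` at arbitrarily small `r`.
  have hk : k ≠ 0 := by
    rintro rfl
    refine hV ?_
    simp only [mul_zero, zero_add, pow_one] at hfa ⊢
    set a := lyapunovCoeffAtInfinity (invertedWeakFocusField p q) (invertDomain U) 1
    have h1 : Tendsto (fun r => |f r / r| - 6 * Real.pi * C * r) (𝓝[>] 0)
        (𝓝 (|a| - 6 * Real.pi * C * 0)) :=
      hfa.abs.sub ((tendsto_id.const_mul _).mono_left nhdsWithin_le_nhds)
    by_contra ha
    refine hfreq ?_
    have h2 : 0 < |a| - 6 * Real.pi * C * 0 := by simpa using ha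
    filter_upwards [h1.eventually_const_lt h2, self_mem_nhdsWithin] with r hr hr0
    have hr0 : 0 < r := hr0
    rw [abs_div, abs_of_pos hr0, sub_pos, lt_div_iff₀ hr0] at hr
    intro hle
    linarith
  have hmain := boxDim_of_displacement hp.1 hq.1 hG hf (by omega) hV hfa hσ hz hlim
  have e : (2 : ℝ) - 2 / (2 * k + 1 : ℕ) = 2 * (1 - 1 / (2 * (k : ℝ) + 1)) := by
    push_cast; ring
  rw [e, ← himg] at hmain
  exact ⟨⟨hmain.1, hmain.2.1⟩, hmain.2.2⟩
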